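/- Let $\mathcal V$ be a real Banach space, let $T>0$, and let the algebraic tensor product $\mathcal V\otimes\mathcal V$ carry a norm with $\|v\otimes w\|\le\|v\|\,\|w\|$ for all $v,w\in\mathcal V$. Write $[v,w]=v\otimes w-w\otimes v$, and let $[\mathcal V,\mathcal V]$ be the completion of the space of finite sums $\sum_i[v_i,w_i]$ in this norm. Let $\triangle=\{(s,t):0\le s\le t\le T\}$, and let $C(\triangle,E)$ be the set of continuous $\alpha:\triangle\to E$ with $\alpha(t,t)=0$ for all $t$. For $\alpha\in C(\triangle,E)$, $E$ a Banach space, and $p>0$ let $$\|\alpha\|_{p\text{-var}}=\Big(\sup_{D}\sum_{j}\|\alpha(t_j,t_{j+1})\|^p\Big)^{1/p},\qquad \omega_p(\alpha,\delta)=\Big(\sup_{|D|\le\delta}\sum_{j}\|\alpha(t_j,t_{j+1})\|^p\Big)^{1/p},$$ with suprema over the finite partitions $D=\{0=t_0<\dots<t_n=T\}$ of $[0,T]$ and $|D|=\max_j(t_{j+1}-t_j)$; $\alpha$ is of vanishing $p$-variation if $\omega_p(\alpha,\delta)\to0$ as $\delta\to0$. For a continuous path $\gamma:[0,T]\to\mathcal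 V$ these notions are applied to $(s,t)\mapsto\gamma(t)-\gamma(s)$, and $C^{p\text{-var}}([0,T],\mathcal V)$ is the set of continuous paths with $\|\gamma\|_{p\text{-var}}<\infty$. For $\gamma\in C^{1\text{-var}}([0,T],\mathcal V)$ its area is $$A(\gamma)(s,t)=\tfrac12\iint_{s<u_1<u_2<t}[d\gamma(u_1),d\gamma(u_2)]=\tfrac12\int_s^t[\gamma(u)-\gamma(s),d\gamma(u)]\in[\mathcal V,\mathcal V],$$ a Riemann--Stieltjes integral. A pair $(\gamma,\alpha)$ with $\gamma\in C([0,T],\mathcal V)$ and $\alpha\in C(\triangle,[\mathcal V,\mathcal V])$ is a geometric $2$-rough path if there are $\gamma_n\in C^{1\text{-var}}([0,T],\mathcal V)$ with $$\lim_{n\to\infty}\big(\|\gamma-\gamma_n\|_{2\text{-var}}^2+\|\alpha-A(\gamma_n)\|_{1\text{-var}}\big)^{1/2}=0 .$$ Let $\mathcal G_2(\mathcal V)$ be the set of continuous paths $\gamma:[0,T]\to\mathcal V$ of vanishing $2$-variation for which there is an $\alpha\in C(\triangle,[\mathcal V,\mathcal V])$ of vanishing $1$-variation such that $(\gamma,\alpha)$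 is a geometric $2$-rough path. Then $$\mathcal G_2(\mathcal V)+\bigcup_{1\le p<2}C^{p\text{-var}}([0,T],\mathcal V)=\mathcal G_2(\mathcal V),$$ where the left-hand side is the set of all sums $\gamma_1+\gamma_2$ with $\gamma_1\in\mathcal G_2(\mathcal V)$ and $\gamma_2\in\bigcup_{1\le p<2}C^{p\text{-var}}([0,T],\mathcal V)$. In particular $\mathcal G_2(\mathcal V)$ is invariant under shifts by paths of finite $p$-variation with $1\le p<2$. -/

import Mathlib

open Set Filter Topology
open scoped TensorProduct ENNReal NNReal Pointwise

noncomputable section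

namespace RoughPath

/-! ### Tensor norms and the Banach space `[V, V]` -/

/-- A norm on the algebraic tensor product `V ⊗ V` with `‖v ⊗ w‖ ≤ ‖v‖ ‖w‖`. -/
structure TensorNorm (V : Type*) [NormedAddCommGroup V] [NormedSpace ℝ V] where
  toSeminorm : Seminorm ℝ (V ⊗[ℝ] V)
  eq_zero_of_norm_eq_zero : ∀ x, toSeminorm x = 0 → x = 0
  norm_tmul_le : ∀ v w : V, toSeminorm (v ⊗ₜ[ℝ] w) ≤ ‖v‖ * ‖w‖

section Bracket

variable {V : Type*} [NormedAddCommGroup V] [NormedSpace ℝ V]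

/-- The algebraic tensor product `V ⊗ V`, to be equipped with the norm `N`. -/
def NormedTensor (_N : TensorNorm V) : Type _ := V ⊗[ℝ] V

instance (N : TensorNorm V) : AddCommGroup (NormedTensor N) :=
  inferInstanceAs (AddCommGroup (V ⊗[ℝ] V))

instance (N : TensorNorm V) : Module ℝ (NormedTensor N) :=
  inferInstanceAs (Module ℝ (V ⊗[ℝ] V))

/-- The norm `N`, as a norm of the additive group `V ⊗ V`. -/
def TensorNorm.toAddGroupNorm (N : TensorNorm V) : AddGroupNorm (NormedTensor N) where
  toFun x := N.toSeminorm x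
  map_zero' := map_zero N.toSeminorm
  add_le' x y := map_add_le_add N.toSeminorm x y
  neg' x := map_neg_eq_map N.toSeminorm x
  eq_zero_of_map_eq_zero' x hx := N.eq_zero_of_norm_eq_zero x hx

instance (N : TensorNorm V) : NormedAddCommGroup (NormedTensor N) :=
  N.toAddGroupNorm.toNormedAddCommGroup

instance (N : TensorNorm V) : NormedSpace ℝ (NormedTensor N) where
  norm_smul_le c x := (map_smul_eq_mul N.toSeminorm c x).le

/-- The algebraic bracket `[v, w] = v ⊗ w - w ⊗ v`. -/
def algBracket (N : TensorNorm V) (v w : V) : NormedTensor N :=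
  (v ⊗ₜ[ℝ] w - w ⊗ₜ[ℝ] v : V ⊗[ℝ] V)

/-- The finite sums `∑ i, [v i, w i]` (this set is closed under scalar multiplication, so it is
the linear span of the brackets), with the norm of `V ⊗ V`. -/
def bracketSpan (N : TensorNorm V) : Submodule ℝ (NormedTensor N) :=
  Submodule.span ℝ (Set.range fun q : V × V => algBracket N q.1 q.2)

/-- The Banach space `[V, V]`: the completion of the space of finite sums `∑ i, [v i, w i]`
with respect to the norm of `V ⊗ V`. -/
abbrev BracketSpace (N : TensorNorm V) : Type _ :=
  UniformSpace.Completion (bracketSpan N)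

/-- The bracket `[v, w]` as an element of `[V, V]`. -/
def bracket (N : TensorNorm V) (v w : V) : BracketSpace N :=
  ((⟨algBracket N v w, Submodule.subset_span ⟨(v, w), rfl⟩⟩ : bracketSpan N) : BracketSpace N)

end Bracket

/-! ### Partitions, `p`-variation and vanishing `p`-variation -/

/-- A finite partition `a = t_0 < t_1 < ⋯ < t_n = b` by points `t_i = pts i` of `[0, T]`.
The values `pts i` for `i > n` are irrelevant. -/
structure Partition (T a b : ℝ) where
  n : ℕ
  pts : ℕ → Icc (0 : ℝ) T
  first : (pts 0 : ℝ) = a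
  last : (pts n : ℝ) = b
  lt_succ : ∀ i < n, pts i < pts (i + 1)

/-- The mesh `max_i |t_{i+1} - t_i|`. -/
def Partition.mesh {T a b : ℝ} (D : Partition T a b) : ℝ≥0 :=
  (Finset.range D.n).sup fun i => nndist (D.pts i) (D.pts (i + 1))

section Variation

variable {T : ℝ} {E : Type*} [NormedAddCommGroup E]

/-- `∑_j ‖α(t_j, t_{j+1})‖ ^ p`. Functions on the triangle `{0 ≤ s ≤ t ≤ T}` are represented by
functions of two arguments in `[0, T]`, whose values at `s > t` are never used. -/
def powSum (p : ℝ) (α : Icc (0 : ℝ) T → Icc (0 : ℝ) T → E) (D : Partition T 0 T) : ℝ≥0∞ :=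
  ∑ i ∈ Finset.range D.n, ‖α (D.pts i) (D.pts (i + 1))‖ₑ ^ p

/-- The `p`-variation `‖α‖_{p-var,[0,T]}`, possibly infinite. -/
def pVar (p : ℝ) (α : Icc (0 : ℝ) T → Icc (0 : ℝ) T → E) : ℝ≥0∞ :=
  (⨆ D : Partition T 0 T, powSum p α D) ^ (1 / p)

/-- `ω_p(α, δ)`: as the `p`-variation, but only over partitions of mesh at most `δ`. -/
def modVar (p : ℝ) (α : Icc (0 : ℝ) T → Icc (0 : ℝ) T → E) (δ : ℝ) : ℝ≥0∞ :=
  (⨆ (D : Partition T 0 T) (_ : (D.mesh : ℝ) ≤ δ), powSum p α D) ^ (1 / p)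

/-- `α` is of vanishing `p`-variation. -/
def VanishingVar (p : ℝ) (α : Icc (0 : ℝ) T → Icc (0 : ℝ) T → E) : Prop :=
  Tendsto (modVar p α) (𝓝[>] 0) (𝓝 0)

/-- `α` is continuous on the triangle `{s ≤ t}` and vanishes on the diagonal. -/
def IsTriangleFun (α : Icc (0 : ℝ) T → Icc (0 : ℝ) T → E) : Prop :=
  ContinuousOn (fun q : Icc (0 : ℝ) T × Icc (0 : ℝ) T => α q.1 q.2) {q | q.1 ≤ q.2} ∧
    ∀ t, α t t = 0

/-- The increments `(s, t) ↦ γ(t) - γ(s)` of a path. -/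
def increment (γ : C(Icc (0 : ℝ) T, E)) (s t : Icc (0 : ℝ) T) : E := γ t - γ s

end Variation

/-- `C^{p-var}([0,T], V)`: the continuous paths of finite `p`-variation. -/
def CpVar (V : Type*) [NormedAddCommGroup V] (T p : ℝ) : Set C(Icc (0 : ℝ) T, V) :=
  {γ | pVar p (increment γ) < ∞}

/-- `C^{0,p-var}([0,T], V)`: the continuous paths of vanishing `p`-variation. -/
def CzeroVar (V : Type*) [NormedAddCommGroup V] (T p : ℝ) : Set C(Icc (0 : ℝ) T, V) :=
  {γ | VanishingVar p (increment γ)}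

/-! ### Riemann-Stieltjes integrals and the area -/

section Area

variable {V : Type*} [NormedAddCommGroup V] [NormedSpace ℝ V] {T : ℝ}

/-- `L` is the Riemann-Stieltjes integral `∫_s^t B(f(u), dg(u))`: the limit, as the mesh tends to
zero, of the Riemann sums over partitions of `[s, t]` with arbitrary intermediate points. -/
def HasRSIntegral {E : Type*} [NormedAddCommGroup E] (B : V → V → E)
    (f g : Icc (0 : ℝ) T → V) (s t : Icc (0 : ℝ) T) (L : E) : Prop :=
  ∀ ε > 0, ∃ δ > 0, ∀ D : Partition T s t, (D.mesh : ℝ) ≤ δ →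
    ∀ ξ : ℕ → Icc (0 : ℝ) T, (∀ i < D.n, D.pts i ≤ ξ i ∧ ξ i ≤ D.pts (i + 1)) →
      ‖(∑ i ∈ Finset.range D.n, B (f (ξ i)) (g (D.pts (i + 1)) - g (D.pts i))) - L‖ < ε

open Classical in
/-- The Riemann-Stieltjes integral `∫_s^t B(f(u), dg(u))` (zero if it does not exist). It is only
applied for bilinear bounded `B` with values in a Banach space, `f` continuous and `g` continuous
of bounded variation, and there it exists. -/
def rsIntegral {E : Type*} [NormedAddCommGroup E] (B : V → V → E)
    (f g : Icc (0 : ℝ) T → V) (s t : Icc (0 : ℝ) T) : E :=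
  if h : ∃ L, HasRSIntegral B f g s t L then h.choose else 0

/-- `A(γ₁, γ₂)(s, t) = ½ ∬_{s<u₁<u₂<t} [dγ₁(u₁), dγ₂(u₂)] = ½ ∫_s^t [γ₁(u) - γ₁(s), dγ₂(u)]`. -/
def areaPair (N : TensorNorm V) (γ₁ γ₂ : C(Icc (0 : ℝ) T, V)) (s t : Icc (0 : ℝ) T) :
    BracketSpace N :=
  (1 / 2 : ℝ) • rsIntegral (bracket N) (fun u => γ₁ u - γ₁ s) γ₂ s t

/-- The area `A(γ) = A(γ, γ)`. -/
def area (N : TensorNorm V) (γ : C(Icc (0 : ℝ) T, V)) :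
    Icc (0 : ℝ) T → Icc (0 : ℝ) T → BracketSpace N :=
  areaPair N γ γ

/-! ### Geometric `2`-rough paths -/

/-- The `2`-rough norm `(‖γ‖_{2-var}² + ‖α‖_{1-var})^{1/2}`. -/
def roughNorm {N : TensorNorm V} (γ : C(Icc (0 : ℝ) T, V))
    (α : Icc (0 : ℝ) T → Icc (0 : ℝ) T → BracketSpace N) : ℝ≥0∞ :=
  (pVar 2 (increment γ) ^ (2 : ℝ) + pVar 1 α) ^ (1 / 2 : ℝ)

/-- `(γ, α)` is a geometric `2`-rough path: it is a limit in `2`-rough norm of paths of bounded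
variation enhanced by their areas. -/
def IsGeometricRoughPath (N : TensorNorm V) (γ : C(Icc (0 : ℝ) T, V))
    (α : Icc (0 : ℝ) T → Icc (0 : ℝ) T → BracketSpace N) : Prop :=
  IsTriangleFun α ∧ ∃ γs : ℕ → C(Icc (0 : ℝ) T, V), (∀ n, γs n ∈ CpVar V T 1) ∧
    Tendsto (fun n => roughNorm (γ - γs n) (α - area N (γs n))) atTop (𝓝 0)

/-- `𝒢₂(V)`: the paths of vanishing `2`-variation that admit an enhancement `α`, of vanishing
`1`-variation, into a geometric `2`-rough path. -/
def G2 (N : TensorNorm V) (T : ℝ) : Set C(Icc (0 : ℝ) T, V) :=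
  {γ | γ ∈ CzeroVar V T 2 ∧
    ∃ α : Icc (0 : ℝ) T → Icc (0 : ℝ) T → BracketSpace N,
      IsTriangleFun α ∧ VanishingVar 1 α ∧ IsGeometricRoughPath N γ α}

end Area

end RoughPath

end

/-!
Adding the zero path shows one inclusion. For the other one, let `γ` be the limit of paths `γ_n` of
bounded variation whose areas converge to `α`, and let `h` have finite `p`-variation with `p < 2`.

The averages `h_δ(t) = ∫_0^1 h(t + δ u) du` are Lipschitz, their `p`-variation is at most that of
`h` by Jensen's inequality (`powVarOn_mollify_le`), and they converge to `h` uniformly. By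
interpolation they converge in `q`-variation for every `q > p` (`exists_tendsto_pVar_sub`). Fix
`q` with `p < q < 2` and let `h_n` be such averages. The area of `γ_n + h_n` is the sum of the area
of `γ_n`, the area of `h_n` and the two mixed areas. Since `1/2 + 1/q > 1`, Young's inequality
bounds the `1`-variation of an area with at most one factor that is controlled only in
`2`-variation by the product of the variation norms of the factors (`pVar_one_bilinArea_le`).
Hence all the terms except the area of `γ_n` form Cauchy sequences in `1`-variation and converge
(`exists_tendsto_bilinArea`), and `γ + h` with the sum of the limits is a geometric `2`-rough path.

The two vanishing conditions hold for every geometric `2`-rough path: paths of bounded variation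
have vanishing `2`-variation and areas of vanishing `1`-variation, and both properties are
preserved by limits in the variation norms (`IsGeometricRoughPath.mem_G2`).

Everything about the Riemann-Stieltjes integral rests on one comparison of Riemann sums
(`enorm_riemannSum_sub_le`): two sums over the same interval differ by at most the oscillation of
the integrand on the scale of the meshes times the total variation of the integrator. It shows that
the integral is the limit of the Riemann sums along clipped uniform grids, uniformly in the
endpoints (`tendstoUniformlyOn_gridSum`), so that bilinearity, continuity and Young's inequality
for the area follow from the corresponding statements on finite sums.
-/

namespace RoughPath

/-! ### Power sums along monotone sequences -/

section PowVar

variable {X : Type*} [LinearOrder X] {E : Type*} [NormedAddCommGroup E]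

/-- The supremum of `∑ ‖f(u_{i+1}) - f(u_i)‖ ^ p` over the finite monotone sequences `u` in `S`,
i.e. the `p`-th power of the `p`-variation of `f` on `S`. As for `eVariationOn`, repetitions are
allowed in `u` and the endpoints of `S` need not occur. -/
noncomputable def powVarOn (p : ℝ) (f : X → E) (S : Set X) : ℝ≥0∞ :=
  ⨆ q : ℕ × {u : ℕ → X // Monotone u ∧ ∀ i, u i ∈ S},
    ∑ i ∈ Finset.range q.1, ‖f (q.2.1 (i + 1)) - f (q.2.1 i)‖ₑ ^ p

theorem sum_le_powVarOn (p : ℝ) (f : X → E) {S : Set X} {u : ℕ → X} (hu : Monotone u)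
    (hS : ∀ i, u i ∈ S) (n : ℕ) :
    ∑ i ∈ Finset.range n, ‖f (u (i + 1)) - f (u i)‖ₑ ^ p ≤ powVarOn p f S :=
  le_iSup (fun q : ℕ × {u : ℕ → X // Monotone u ∧ ∀ i, u i ∈ S} =>
    ∑ i ∈ Finset.range q.1, ‖f (q.2.1 (i + 1)) - f (q.2.1 i)‖ₑ ^ p) ⟨n, u, hu, hS⟩

theorem powVarOn_empty (p : ℝ) (f : X → E) : powVarOn p f ∅ = 0 := by
  refine le_antisymm (iSup_le ?_) zero_le
  rintro ⟨n, u, hu, hS⟩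
  exact (hS 0).elim

theorem powVarOn_mono (p : ℝ) (f : X → E) {S S' : Set X} (h : S ⊆ S') :
    powVarOn p f S ≤ powVarOn p f S' := by
  refine iSup_le ?_
  rintro ⟨n, u, hu, hS⟩
  exact sum_le_powVarOn p f hu (fun i => h (hS i)) n

/-- The `p`-th power of the `p`-variation is superadditive, since monotone sequences in adjacent
sets can be juxtaposed. -/
theorem powVarOn_add_le_union (p : ℝ) (f : X → E) {S S' : Set X}
    (h : ∀ x ∈ S, ∀ y ∈ S', x ≤ y) :
    powVarOn p f S + powVarOn p f S' ≤ powVarOn p f (S ∪ S') := by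
  by_cases hs : S = ∅
  · simp [hs, powVarOn_empty]
  by_cases ht : S' = ∅
  · simp [ht, powVarOn_empty]
  obtain ⟨x, hx⟩ := nonempty_iff_ne_empty.2 hs
  obtain ⟨y, hy⟩ := nonempty_iff_ne_empty.2 ht
  have : Nonempty {u : ℕ → X // Monotone u ∧ ∀ i, u i ∈ S} :=
    ⟨fun _ => x, monotone_const, fun _ => hx⟩
  have : Nonempty {u : ℕ → X // Monotone u ∧ ∀ i, u i ∈ S'} :=
    ⟨fun _ => y, monotone_const, fun _ => hy⟩
  refine ENNReal.iSup_add_iSup_le ?_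
  rintro ⟨n, u, hu, us⟩ ⟨m, v, hv, vt⟩
  let w i := if i ≤ n then u i else v (i - (n + 1))
  calc (∑ i ∈ Finset.range n, ‖f (u (i + 1)) - f (u i)‖ₑ ^ p) +
          ∑ i ∈ Finset.range m, ‖f (v (i + 1)) - f (v i)‖ₑ ^ p
      = (∑ i ∈ Finset.range n, ‖f (w (i + 1)) - f (w i)‖ₑ ^ p) +
          ∑ i ∈ Finset.range m, ‖f (w (n + 1 + i + 1)) - f (w (n + 1 + i))‖ₑ ^ p := by
        dsimp only [w]
        congr 1
        · grind [Finset.sum_congr]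
        · grind
    _ ≤ ∑ i ∈ Finset.range (n + 1 + m), ‖f (w (i + 1)) - f (w i)‖ₑ ^ p := by
        rw [Finset.sum_range_add]
        gcongr
        omega
    _ ≤ powVarOn p f (S ∪ S') := sum_le_powVarOn p f (by grind [Monotone]) (by grind) _

theorem sum_powVarOn_Icc_le (p : ℝ) (f : X → E) {x : ℕ → X} (hx : Monotone x) (n : ℕ) :
    ∑ i ∈ Finset.range n, powVarOn p f (Icc (x i) (x (i + 1))) ≤
      powVarOn p f (Icc (x 0) (x n)) := by
  induction n with
  | zero => simp
  | succ n ih =>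
    rw [Finset.sum_range_succ]
    refine (add_le_add_left ih _).trans ?_
    refine (powVarOn_add_le_union p f fun a ha b hb => ha.2.trans hb.1).trans ?_
    rw [Icc_union_Icc_eq_Icc (hx (Nat.zero_le n)) (hx (Nat.le_succ n))]

end PowVar

/-! ### Partitions and monotone sequences -/

section Partitions

variable {T : ℝ} {E : Type*} [NormedAddCommGroup E]

theorem Partition.monotone {a b : ℝ} (D : Partition T a b) :
    Monotone fun i => D.pts (min i D.n) := by
  refine monotone_nat_of_le_succ fun i => ?_
  rcases lt_or_ge i D.n with h | h
  · simpa only [min_eq_left h.le, min_eq_left (Nat.succ_le_of_lt h)] using (D.lt_succ i h).le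
  · simp only [min_eq_right h, min_eq_right (h.trans (Nat.le_succ i)), le_refl]

/-- Omitting repetitions turns a monotone sequence into a partition. -/
theorem exists_partition_sum_eq {M : Type*} [AddCommMonoid M]
    (F : Icc (0 : ℝ) T → Icc (0 : ℝ) T → M) (hF : ∀ x, F x x = 0)
    {u : ℕ → Icc (0 : ℝ) T} (hu : Monotone u) (n : ℕ) :
    ∃ D : Partition T (u 0) (u n),
      (∑ i ∈ Finset.range D.n, F (D.pts i) (D.pts (i + 1)) =
        ∑ i ∈ Finset.range n, F (u i) (u (i + 1))) ∧
      ∀ i < D.n, ∃ j < n, D.pts i = u j ∧ D.pts (i + 1) = u (j + 1) := by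
  induction n with
  | zero => exact ⟨⟨0, u, rfl, rfl, fun i hi => by simp at hi⟩, by simp, fun i hi => by simp at hi⟩
  | succ n ih =>
    obtain ⟨D, hD, hD'⟩ := ih
    rcases eq_or_lt_of_le (hu (Nat.le_succ n)) with h | h
    · refine ⟨⟨D.n, D.pts, D.first, D.last.trans (congrArg Subtype.val h), D.lt_succ⟩, ?_, ?_⟩
      · have h0 : F (u n) (u (n + 1)) = 0 := by
          rw [show u (n + 1) = u n from h.symm, hF]
        rw [Finset.sum_range_succ, h0, add_zero, ← hD]
      · intro i hi
        obtain ⟨j, hj, h1⟩ := hD' i hi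
        exact ⟨j, hj.trans (Nat.lt_succ_self n), h1⟩
    · have hlast : D.pts D.n = u n := Subtype.ext D.last
      refine ⟨⟨D.n + 1, fun i => if i ≤ D.n then D.pts i else u (n + 1), ?_, ?_, ?_⟩, ?_, ?_⟩
      · simpa using D.first
      · simp
      · intro i hi
        rcases Nat.lt_succ_iff_lt_or_eq.1 hi with h' | rfl
        · simpa [h'.le, Nat.succ_le_of_lt h'] using D.lt_succ i h'
        · simpa [hlast] using h
      · rw [Finset.sum_range_succ, Finset.sum_range_succ, ← hD]
        congr 1
        · refine Finset.sum_congr rfl fun i hi => ?_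
          have h' := Finset.mem_range.1 hi
          simp [h'.le, Nat.succ_le_of_lt h']
        · simp [hlast]
      · intro i hi
        rcases Nat.lt_succ_iff_lt_or_eq.1 hi with h' | rfl
        · obtain ⟨j, hj, h1⟩ := hD' i h'
          exact ⟨j, hj.trans (Nat.lt_succ_self n), by
            simpa [h'.le, Nat.succ_le_of_lt h'] using h1⟩
        · exact ⟨n, Nat.lt_succ_self n, by simp [hlast]⟩

/-- Inserting the endpoints `0` and `T` into a monotone sequence only increases the power sum. -/
theorem sum_le_iSup_powSum {p : ℝ} (hp : 0 < p) {α : Icc (0 : ℝ) T → Icc (0 : ℝ) T → E}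
    (hα : ∀ x, α x x = 0) {u : ℕ → Icc (0 : ℝ) T} (hu : Monotone u) (n : ℕ) :
    ∑ i ∈ Finset.range n, ‖α (u i) (u (i + 1))‖ₑ ^ p ≤ ⨆ D : Partition T 0 T, powSum p α D := by
  have hT : 0 ≤ T := (u 0).2.1.trans (u 0).2.2
  let w : ℕ → Icc (0 : ℝ) T := fun i =>
    if i = 0 then ⟨0, le_rfl, hT⟩ else if i ≤ n + 1 then u (i - 1) else ⟨T, hT, le_rfl⟩
  have hw : Monotone w := by
    refine monotone_nat_of_le_succ fun i => ?_
    rcases i with _ | i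
    · exact (w 1).2.1
    · rcases le_or_gt (i + 2) (n + 1) with h | h
      · simpa [w, show i ≤ n by omega, show i + 1 ≤ n by omega] using hu (Nat.le_succ i)
      · have h2 : w (i + 1 + 1) = ⟨T, hT, le_rfl⟩ := by
          simp [w, show ¬ i + 1 ≤ n by omega]
        rw [h2]
        exact (w (i + 1)).2.2
  obtain ⟨D, hD, -⟩ := exists_partition_sum_eq (fun x y => ‖α x y‖ₑ ^ p)
    (fun x => by simp [hα, hp]) hw (n + 2)
  have hD0 : (w 0 : ℝ) = 0 := by simp [w]
  have hDT : (w (n + 2) : ℝ) = T := by simp [w]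
  let D' : Partition T 0 T :=
    ⟨D.n, D.pts, D.first.trans hD0, D.last.trans hDT, D.lt_succ⟩
  refine le_trans ?_ (le_iSup _ D')
  change _ ≤ ∑ i ∈ Finset.range D.n, ‖α (D.pts i) (D.pts (i + 1))‖ₑ ^ p
  rw [hD, Finset.sum_range_succ, Finset.sum_range_succ']
  refine le_add_right (le_add_right (le_of_eq (Finset.sum_congr rfl fun i hi => ?_)))
  have h' := Finset.mem_range.1 hi
  simp [w, h'.le, Nat.succ_le_of_lt h']

/-- The `p`-variation bounds the values of a function on the triangle. -/
theorem enorm_le_pVar {p : ℝ} (hp : 0 < p) {α : Icc (0 : ℝ) T → Icc (0 : ℝ) T → E}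
    (hα : ∀ x, α x x = 0) {s t : Icc (0 : ℝ) T} (hst : s ≤ t) : ‖α s t‖ₑ ≤ pVar p α := by
  have h := sum_le_iSup_powSum hp hα (u := fun i => if i = 0 then s else t)
    (monotone_nat_of_le_succ fun i => by
      rcases i with _ | i
      · simpa using hst
      · simp) 1
  have h' := ENNReal.rpow_le_rpow h (one_div_pos.2 hp).le
  simp only [Finset.sum_range_one, ← ENNReal.rpow_mul, mul_one_div_cancel hp.ne',
    ENNReal.rpow_one] at h'
  simpa [pVar] using h'

theorem powSum_le_pVar_rpow {p : ℝ} (hp : 0 < p) (α : Icc (0 : ℝ) T → Icc (0 : ℝ) T → E)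
    (D : Partition T 0 T) : powSum p α D ≤ pVar p α ^ p := by
  rw [pVar, ← ENNReal.rpow_mul, one_div_mul_cancel hp.ne', ENNReal.rpow_one]
  exact le_iSup _ D

theorem pVar_le_iff {p : ℝ} (hp : 0 < p) (α : Icc (0 : ℝ) T → Icc (0 : ℝ) T → E) (c : ℝ≥0∞) :
    pVar p α ≤ c ↔ ∀ D, powSum p α D ≤ c ^ p := by
  rw [pVar, one_div, ENNReal.rpow_inv_le_iff hp, iSup_le_iff]

theorem modVar_le_iff {p : ℝ} (hp : 0 < p) (α : Icc (0 : ℝ) T → Icc (0 : ℝ) T → E) (δ : ℝ)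
    (c : ℝ≥0∞) :
    modVar p α δ ≤ c ↔ ∀ D : Partition T 0 T, (D.mesh : ℝ) ≤ δ → powSum p α D ≤ c ^ p := by
  rw [modVar, one_div, ENNReal.rpow_inv_le_iff hp]
  simp only [iSup_le_iff]

theorem iSup_powSum_increment {p : ℝ} (hp : 0 < p) (γ : C(Icc (0 : ℝ) T, E)) :
    ⨆ D : Partition T 0 T, powSum p (increment γ) D = powVarOn p γ univ := by
  refine le_antisymm (iSup_le fun D => ?_) (iSup_le ?_)
  · refine le_trans (le_of_eq ?_) (sum_le_powVarOn p γ D.monotone (fun _ => mem_univ _) D.n)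
    refine Finset.sum_congr rfl fun i hi => ?_
    have h' := Finset.mem_range.1 hi
    simp only [min_eq_left h'.le, min_eq_left (Nat.succ_le_of_lt h'), increment]
  · rintro ⟨n, u, hu, -⟩
    exact sum_le_iSup_powSum hp (α := increment γ) (fun x => sub_self _) hu n

theorem pVar_increment {p : ℝ} (hp : 0 < p) (γ : C(Icc (0 : ℝ) T, E)) :
    pVar p (increment γ) = powVarOn p γ univ ^ (1 / p) := by
  rw [pVar, iSup_powSum_increment hp]

theorem powVarOn_eq_pVar_rpow {p : ℝ} (hp : 0 < p) (γ : C(Icc (0 : ℝ) T, E)) :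
    powVarOn p γ univ = pVar p (increment γ) ^ p := by
  rw [pVar_increment hp, ← ENNReal.rpow_mul, one_div_mul_cancel hp.ne', ENNReal.rpow_one]

theorem mem_CpVar_iff {p : ℝ} (hp : 0 < p) (γ : C(Icc (0 : ℝ) T, E)) :
    γ ∈ CpVar E T p ↔ powVarOn p γ univ < ∞ := by
  change pVar p (increment γ) < ∞ ↔ _
  rw [pVar_increment hp, ENNReal.rpow_lt_top_iff_of_pos (one_div_pos.2 hp)]

/-! ### Minkowski's inequality -/

theorem powSum_rpow_add_le {p : ℝ} (hp : 1 ≤ p) (α β : Icc (0 : ℝ) T → Icc (0 : ℝ) T → E)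
    (D : Partition T 0 T) :
    powSum p (α + β) D ^ (1 / p) ≤ powSum p α D ^ (1 / p) + powSum p β D ^ (1 / p) := by
  refine le_trans ?_ (ENNReal.Lp_add_le _ _ _ hp)
  refine ENNReal.rpow_le_rpow (Finset.sum_le_sum fun i _ => ?_) (by positivity)
  exact ENNReal.rpow_le_rpow (enorm_add_le _ _) (by positivity)

theorem pVar_add_le {p : ℝ} (hp : 1 ≤ p) (α β : Icc (0 : ℝ) T → Icc (0 : ℝ) T → E) :
    pVar p (α + β) ≤ pVar p α + pVar p β := by
  have hp0 : 0 < p := by linarith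
  rw [pVar_le_iff hp0]
  intro D
  rw [← ENNReal.rpow_inv_le_iff hp0, ← one_div]
  refine (powSum_rpow_add_le hp α β D).trans (add_le_add ?_ ?_) <;>
    exact ENNReal.rpow_le_rpow (le_iSup _ D) (by positivity)

theorem modVar_add_le {p : ℝ} (hp : 1 ≤ p) (α β : Icc (0 : ℝ) T → Icc (0 : ℝ) T → E) (δ : ℝ) :
    modVar p (α + β) δ ≤ modVar p α δ + modVar p β δ := by
  have hp0 : 0 < p := by linarith
  rw [modVar_le_iff hp0]
  intro D hD
  rw [← ENNReal.rpow_inv_le_iff hp0, ← one_div]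
  refine (powSum_rpow_add_le hp α β D).trans (add_le_add ?_ ?_) <;>
    exact ENNReal.rpow_le_rpow (le_iSup₂ (f := fun D (_ : (D.mesh : ℝ) ≤ δ) => powSum p _ D) D hD)
      (by positivity)

theorem modVar_le_pVar {p : ℝ} (hp : 0 < p) (α : Icc (0 : ℝ) T → Icc (0 : ℝ) T → E) (δ : ℝ) :
    modVar p α δ ≤ pVar p α := by
  rw [modVar_le_iff hp]
  exact fun D _ => powSum_le_pVar_rpow hp α D

theorem pVar_neg (p : ℝ) (α : Icc (0 : ℝ) T → Icc (0 : ℝ) T → E) : pVar p (-α) = pVar p α := by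
  simp [pVar, powSum]

theorem pVar_sub_comm (p : ℝ) (α β : Icc (0 : ℝ) T → Icc (0 : ℝ) T → E) :
    pVar p (α - β) = pVar p (β - α) := by
  rw [← pVar_neg, neg_sub]

/-- Only the values on the triangle matter for the `p`-variation. -/
theorem pVar_mono {p : ℝ} (hp : 0 < p) {α β : Icc (0 : ℝ) T → Icc (0 : ℝ) T → E}
    (h : ∀ s t, s ≤ t → ‖α s t‖ₑ ≤ ‖β s t‖ₑ) : pVar p α ≤ pVar p β := by
  rw [pVar_le_iff hp]
  refine fun D => le_trans (Finset.sum_le_sum fun i hi => ?_) (powSum_le_pVar_rpow hp β D)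
  exact ENNReal.rpow_le_rpow (h _ _ (D.lt_succ i (Finset.mem_range.1 hi)).le) hp.le

theorem increment_add (γ γ' : C(Icc (0 : ℝ) T, E)) :
    increment (γ + γ') = increment γ + increment γ' := by
  funext s t
  simp only [increment, ContinuousMap.add_apply, Pi.add_apply]
  abel

theorem increment_sub (γ γ' : C(Icc (0 : ℝ) T, E)) :
    increment (γ - γ') = increment γ - increment γ' := by
  funext s t
  simp only [increment, ContinuousMap.sub_apply, Pi.sub_apply]
  abel

/-- Functions of vanishing `p`-variation are closed under limits in `p`-variation. -/
theorem VanishingVar.of_tendsto {p : ℝ} (hp : 1 ≤ p)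
    {α : Icc (0 : ℝ) T → Icc (0 : ℝ) T → E} {β : ℕ → Icc (0 : ℝ) T → Icc (0 : ℝ) T → E}
    (hβ : ∀ n, VanishingVar p (β n))
    (h : Tendsto (fun n => pVar p (α - β n)) atTop (𝓝 0)) : VanishingVar p α := by
  rw [VanishingVar, ENNReal.tendsto_nhds_zero]
  intro ε hε
  have hε2 : 0 < ε / 2 := ENNReal.half_pos hε.ne'
  obtain ⟨n, hn⟩ := (ENNReal.tendsto_nhds_zero.1 h _ hε2).exists
  filter_upwards [ENNReal.tendsto_nhds_zero.1 (hβ n) _ hε2] with δ hδ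
  calc modVar p α δ = modVar p ((α - β n) + β n) δ := by rw [sub_add_cancel]
    _ ≤ modVar p (α - β n) δ + modVar p (β n) δ := modVar_add_le hp _ _ _
    _ ≤ ε / 2 + ε / 2 := add_le_add ((modVar_le_pVar (by linarith) _ _).trans hn) hδ
    _ = ε := ENNReal.add_halves ε

end Partitions

/-! ### Hölder's inequality -/

section Hoelder

variable {ι : Type*}

theorem sum_mul_rpow_le (s : Finset ι) (a b : ι → ℝ≥0∞) {p q : ℝ} (hp : 0 < p) (hq : 0 < q) :
    ∑ i ∈ s, (a i * b i) ^ (1 / p + 1 / q)⁻¹ ≤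
      ((∑ i ∈ s, a i ^ p) ^ (1 / p) * (∑ i ∈ s, b i ^ q) ^ (1 / q)) ^ (1 / p + 1 / q)⁻¹ := by
  set θ := 1 / p + 1 / q with hθ
  have hθ0 : 0 < θ := by positivity
  have hconj : (p * θ).HolderConjugate (q * θ) := by
    rw [Real.holderConjugate_iff]
    constructor
    · rw [hθ]
      field_simp
      linarith
    · rw [hθ]
      field_simp
  have h := ENNReal.inner_le_Lp_mul_Lq s (fun i => a i ^ θ⁻¹) (fun i => b i ^ θ⁻¹) hconj
  have e1 : ∀ x : ℝ≥0∞, ∀ r : ℝ, (x ^ θ⁻¹) ^ (r * θ) = x ^ r := fun x r => by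
    rw [← ENNReal.rpow_mul]
    congr 1
    field_simp
  simp only [e1] at h
  simp only [ENNReal.mul_rpow_of_nonneg _ _ (inv_pos.2 hθ0).le]
  refine h.trans (le_of_eq ?_)
  rw [← ENNReal.rpow_mul, ← ENNReal.rpow_mul]
  congr 2 <;> field_simp

theorem sum_rpow_le_rpow_sum (s : Finset ι) (x : ι → ℝ≥0∞) {θ : ℝ} (hθ : 1 ≤ θ) :
    ∑ i ∈ s, x i ^ θ ≤ (∑ i ∈ s, x i) ^ θ := by
  classical
  induction s using Finset.induction_on with
  | empty => simp
  | insert i s hi ih =>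
    rw [Finset.sum_insert hi, Finset.sum_insert hi]
    exact (add_le_add_right ih _).trans (ENNReal.add_rpow_le_rpow_add _ _ hθ)

/-- Hölder's inequality for exponents with `1/p + 1/q ≥ 1`. -/
theorem sum_mul_le_of_one_le (s : Finset ι) (a b : ι → ℝ≥0∞) {p q : ℝ} (hp : 0 < p) (hq : 0 < q)
    (hpq : 1 ≤ 1 / p + 1 / q) :
    ∑ i ∈ s, a i * b i ≤ (∑ i ∈ s, a i ^ p) ^ (1 / p) * (∑ i ∈ s, b i ^ q) ^ (1 / q) := by
  have hθ0 : 0 < 1 / p + 1 / q := by positivity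
  have h := ENNReal.rpow_le_rpow (sum_mul_rpow_le s a b hp hq) hθ0.le
  rw [← ENNReal.rpow_mul, inv_mul_cancel₀ hθ0.ne', ENNReal.rpow_one] at h
  refine le_trans ?_ h
  refine le_trans (le_of_eq ?_) (sum_rpow_le_rpow_sum s _ hpq)
  refine Finset.sum_congr rfl fun i _ => ?_
  rw [← ENNReal.rpow_mul, inv_mul_cancel₀ hθ0.ne', ENNReal.rpow_one]

/-- The smallest of `n + 1` products is at most `(n + 1) ^ (-(1/p + 1/q))` times the product of the
`ℓ^p` and `ℓ^q` norms. -/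
theorem exists_mul_le (n : ℕ) (a b : ℕ → ℝ≥0∞) {p q : ℝ} (hp : 0 < p) (hq : 0 < q) :
    ∃ k < n + 1, a k * b k ≤ ((n + 1 : ℕ) : ℝ≥0∞) ^ (-(1 / p + 1 / q)) *
      ((∑ i ∈ Finset.range (n + 1), a i ^ p) ^ (1 / p) *
        (∑ i ∈ Finset.range (n + 1), b i ^ q) ^ (1 / q)) := by
  have hh := sum_mul_rpow_le (Finset.range (n + 1)) a b hp hq
  set θ := 1 / p + 1 / q with hθ
  set M := (∑ i ∈ Finset.range (n + 1), a i ^ p) ^ (1 / p) *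
        (∑ i ∈ Finset.range (n + 1), b i ^ q) ^ (1 / q) with hM
  have hθ0 : 0 < θ := by positivity
  by_contra! hcon
  have h0 : ((n + 1 : ℕ) : ℝ≥0∞) ≠ 0 := by simp
  have ht : ((n + 1 : ℕ) : ℝ≥0∞) ≠ ∞ := ENNReal.natCast_ne_top _
  have hlt : ∑ i ∈ Finset.range (n + 1), (((n + 1 : ℕ) : ℝ≥0∞) ^ (-θ) * M) ^ θ⁻¹ <
      ∑ i ∈ Finset.range (n + 1), (a i * b i) ^ θ⁻¹ := by
    refine ENNReal.sum_lt_sum_of_nonempty ⟨0, by simp⟩ fun i hi => ?_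
    exact ENNReal.rpow_lt_rpow (hcon i (Finset.mem_range.1 hi)) (inv_pos.2 hθ0)
  refine (hlt.trans_le hh).ne ?_
  rw [Finset.sum_const, Finset.card_range, nsmul_eq_mul,
    ENNReal.mul_rpow_of_nonneg _ _ (inv_pos.2 hθ0).le, ← ENNReal.rpow_mul, ← mul_assoc,
    neg_mul, mul_inv_cancel₀ hθ0.ne', ENNReal.rpow_neg_one, ENNReal.mul_inv_cancel h0 ht, one_mul]

/-- The constant `∑ k ^ (-θ)` in Young's inequality. -/
noncomputable def youngConst (θ : ℝ) : ℝ≥0∞ := ∑' k : ℕ, ((k + 1 : ℕ) : ℝ≥0∞) ^ (-θ)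

theorem youngConst_lt_top {θ : ℝ} (hθ : 1 < θ) : youngConst θ < ∞ := by
  have h : Summable fun k : ℕ => (((k + 1 : ℕ) : ℝ≥0) ^ θ)⁻¹ :=
    NNReal.summable_nat_add (fun k : ℕ => ((k : ℝ≥0) ^ θ)⁻¹) (NNReal.summable_rpow_inv.2 hθ) 1
  have h2 := ENNReal.tsum_coe_ne_top_iff_summable.2 h
  refine lt_of_eq_of_lt (tsum_congr fun k => ?_) h2.lt_top
  rw [ENNReal.rpow_neg, ENNReal.coe_inv (by positivity), ENNReal.coe_rpow_of_nonneg _ (by linarith)]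
  simp

end Hoelder

/-! ### Young's inequality for Riemann sums -/

/-- The effect on a sum over consecutive points of omitting the point with index `k + 1`. -/
theorem sum_skip {X M : Type*} [AddCommGroup M] (F : X → X → M) (u : ℕ → X) (k m : ℕ) :
    ∑ j ∈ Finset.range (k + 2 + m), F (u j) (u (j + 1)) =
      (∑ j ∈ Finset.range (k + 1 + m), F (if j ≤ k then u j else u (j + 1))
        (if j + 1 ≤ k then u (j + 1) else u (j + 1 + 1))) +
      (F (u k) (u (k + 1)) + F (u (k + 1)) (u (k + 2)) - F (u k) (u (k + 2))) := by
  rw [Finset.sum_range_add, Finset.sum_range_succ, Finset.sum_range_succ, Finset.sum_range_add,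
    Finset.sum_range_succ]
  have h1 : ∑ j ∈ Finset.range k, F (if j ≤ k then u j else u (j + 1))
        (if j + 1 ≤ k then u (j + 1) else u (j + 1 + 1)) =
      ∑ j ∈ Finset.range k, F (u j) (u (j + 1)) := by
    refine Finset.sum_congr rfl fun j hj => ?_
    have h' := Finset.mem_range.1 hj
    rw [if_pos h'.le, if_pos (Nat.succ_le_of_lt h')]
  have h2 : ∑ j ∈ Finset.range m, F (if k + 1 + j ≤ k then u (k + 1 + j) else u (k + 1 + j + 1))
        (if k + 1 + j + 1 ≤ k then u (k + 1 + j + 1) else u (k + 1 + j + 1 + 1)) =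
      ∑ j ∈ Finset.range m, F (u (k + 2 + j)) (u (k + 2 + j + 1)) := by
    refine Finset.sum_congr rfl fun j _ => ?_
    rw [if_neg (by omega), if_neg (by omega), show k + 1 + j + 1 = k + 2 + j by omega]
  rw [h1, h2, if_pos le_rfl, if_neg (by omega)]
  abel

section Young

variable {X : Type*} [LinearOrder X]
  {V : Type*} [NormedAddCommGroup V] [NormedSpace ℝ V]
  {E : Type*} [NormedAddCommGroup E] [NormedSpace ℝ E]

theorem enorm_apply_apply_le (B : V →L[ℝ] V →L[ℝ] E) (v w : V) :
    ‖B v w‖ₑ ≤ ‖B‖ₑ * ‖v‖ₑ * ‖w‖ₑ :=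
  ((B v).le_opENorm w).trans (mul_le_mul_left (B.le_opENorm v) _)

/-- Young's inequality: the points of the Riemann sum are removed one at a time, always the one
for which `exists_mul_le` makes the change of the sum small. -/
theorem enorm_sum_le_young (B : V →L[ℝ] V →L[ℝ] E) (f g : X → V) {p q : ℝ} (hp : 0 < p)
    (hq : 0 < q) {S : Set X} (n : ℕ) {u : ℕ → X} (hu : Monotone u) (hS : ∀ i, u i ∈ S) :
    ‖∑ i ∈ Finset.range (n + 1), B (f (u i) - f (u 0)) (g (u (i + 1)) - g (u i))‖ₑ ≤
      (∑ k ∈ Finset.range n, ((k + 1 : ℕ) : ℝ≥0∞) ^ (-(1 / p + 1 / q))) *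
        (‖B‖ₑ * (powVarOn p f S ^ (1 / p) * powVarOn q g S ^ (1 / q))) := by
  induction n generalizing u with
  | zero => simp
  | succ n ih =>
    obtain ⟨k, hk, hkle⟩ := exists_mul_le n (fun i => ‖f (u (i + 1)) - f (u i)‖ₑ)
      (fun i => ‖g (u (i + 1 + 1)) - g (u (i + 1))‖ₑ) hp hq
    obtain ⟨m, rfl⟩ := Nat.exists_eq_add_of_le (Nat.le_of_lt_succ hk)
    let v : ℕ → X := fun j => if j ≤ k then u j else u (j + 1)
    have hv : Monotone v := by
      refine monotone_nat_of_le_succ fun j => ?_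
      dsimp only [v]
      split_ifs
      · exact hu (by omega)
      · exact hu (by omega)
      · omega
      · exact hu (by omega)
    have hvS : ∀ j, v j ∈ S := fun j => by
      dsimp only [v]
      split_ifs <;> exact hS _
    have hv0 : v 0 = u 0 := by simp [v]
    have hskip := sum_skip (fun x y => B (f x - f (u 0)) (g y - g x)) u k m
    rw [show k + m + 1 + 1 = k + 2 + m by omega, hskip, Finset.sum_range_succ _ (k + m), add_mul]
    refine (enorm_add_le _ _).trans (add_le_add ?_ ?_)
    · have := ih hv hvS
      rw [hv0, show k + m + 1 = k + 1 + m by omega] at this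
      exact this
    · -- Omitting the point `u (k + 1)` changes the sum by a single product of increments.
      have hcorr : B (f (u k) - f (u 0)) (g (u (k + 1)) - g (u k)) +
            B (f (u (k + 1)) - f (u 0)) (g (u (k + 2)) - g (u (k + 1))) -
            B (f (u k) - f (u 0)) (g (u (k + 2)) - g (u k)) =
          B (f (u (k + 1)) - f (u k)) (g (u (k + 2)) - g (u (k + 1))) := by
        simp only [map_sub, sub_apply]
        abel
      rw [hcorr]
      refine (enorm_apply_apply_le B _ _).trans ?_
      rw [mul_assoc, mul_left_comm (_ ^ (-(1 / p + 1 / q)))]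
      refine mul_le_mul_right (hkle.trans ?_) _
      gcongr
      · exact sum_le_powVarOn p f hu hS _
      · exact sum_le_powVarOn q g (u := fun i => u (i + 1))
          (fun i j h => hu (Nat.succ_le_succ h)) (fun i => hS _) _

theorem enorm_sum_le_youngConst (B : V →L[ℝ] V →L[ℝ] E) (f g : X → V) {p q : ℝ} (hp : 0 < p)
    (hq : 0 < q) {S : Set X} (n : ℕ) {u : ℕ → X} (hu : Monotone u) (hS : ∀ i, u i ∈ S) :
    ‖∑ i ∈ Finset.range (n + 1), B (f (u i) - f (u 0)) (g (u (i + 1)) - g (u i))‖ₑ ≤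
      youngConst (1 / p + 1 / q) *
        (‖B‖ₑ * (powVarOn p f S ^ (1 / p) * powVarOn q g S ^ (1 / q))) :=
  (enorm_sum_le_young B f g hp hq n hu hS).trans
    (mul_le_mul_left (ENNReal.sum_le_tsum _) _)

end Young

/-! ### Comparison of Riemann sums -/

section Overlap

variable {X : Type*} [LinearOrder X]
  {V : Type*} [NormedAddCommGroup V] [NormedSpace ℝ V]
  {E : Type*} [NormedAddCommGroup E] [NormedSpace ℝ E]

/-- The Riemann sum `∑ B(f(ξ_i) - c, g(x_{i+1}) - g(x_i))`. -/
noncomputable def riemannSum (B : V →L[ℝ] V →L[ℝ] E) (f g : X → V) (c : V) (x ξ : ℕ → X)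
    (n : ℕ) : E :=
  ∑ i ∈ Finset.range n, B (f (ξ i) - c) (g (x (i + 1)) - g (x i))

/-- Both differences are the increment of `g` over `[a, b] ∩ [c, d]`. -/
theorem sub_clip_comm {G : Type*} [AddCommGroup G] (g : X → G) {a b c d : X}
    (hab : a ≤ b) (hcd : c ≤ d) :
    g (max a (min b d)) - g (max a (min b c)) = g (max c (min d b)) - g (max c (min d a)) := by
  rcases le_total a d with had | had <;> rcases le_total c b with hcb | hcb
  · rw [max_eq_right (le_min hab had), min_eq_right hcb, max_eq_right (le_min hcd hcb),
      min_eq_right had, min_comm, max_comm]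
  · rw [min_eq_left (hcb.trans hcd), min_eq_left hcb, min_eq_right (hcb.trans hcd),
      min_eq_right had, max_eq_left hcb, max_eq_left (hab.trans hcb), sub_self, sub_self]
  · rw [min_eq_right (had.trans hab), min_eq_right hcb, min_eq_left (had.trans hab),
      min_eq_left had, max_eq_left had, max_eq_left (hcd.trans had), sub_self, sub_self]
  · rw [min_eq_right (had.trans hab), min_eq_right (hcd.trans (had.trans hab)),
      min_eq_left (had.trans hab), min_eq_left had, max_eq_left had,
      max_eq_left (hcd.trans had), sub_self, sub_self]

/-- The increment of `g` over `[a, b] ∩ [c, d]` vanishes if the intervals are disjoint. -/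
theorem sub_clip_eq_zero {G : Type*} [AddCommGroup G] (g : X → G) {a b c d : X}
    (hcd : c ≤ d) (h : ¬(a ≤ d ∧ c ≤ b)) : g (max a (min b d)) - g (max a (min b c)) = 0 := by
  rcases lt_or_ge d a with had | had
  · rw [max_eq_left ((min_le_right b d).trans had.le),
      max_eq_left ((min_le_right b c).trans (hcd.trans had.le)), sub_self]
  · have hbc : b ≤ c := le_of_not_ge fun h' => h ⟨had, h'⟩
    rw [min_eq_left hbc, min_eq_left (hbc.trans hcd), sub_self]

/-- The increment of `g` over `[a, b]` is the sum of its increments over the intersections of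
`[a, b]` with the consecutive intervals of a sequence that starts before `a` and ends
after `b`. -/
theorem sum_sub_clip {G : Type*} [AddCommGroup G] (g : X → G) {a b : X}
    (hab : a ≤ b) {y : ℕ → X} {m : ℕ} (h0 : y 0 ≤ a)
    (hm : b ≤ y m) :
    ∑ j ∈ Finset.range m, (g (max a (min b (y (j + 1)))) - g (max a (min b (y j)))) =
      g b - g a := by
  rw [Finset.sum_range_sub (fun j => g (max a (min b (y j)))), min_eq_left hm, max_eq_right hab,
    max_eq_left ((min_le_right _ _).trans h0)]

/-- Two Riemann sums over `[s, t]` are compared by expanding both over the pairwise intersections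
of their intervals. -/
theorem enorm_riemannSum_sub_le (B : V →L[ℝ] V →L[ℝ] E) (f g : X → V) (c : V)
    {x y ξ η : ℕ → X} (hx : Monotone x) (hy : Monotone y) {n m : ℕ} (h0 : x 0 = y 0)
    (h1 : x n = y m) {ε : ℝ≥0∞}
    (hclose : ∀ i < n, ∀ j < m, x i ≤ y (j + 1) → y j ≤ x (i + 1) →
      ‖f (ξ i) - f (η j)‖ₑ ≤ ε) :
    ‖riemannSum B f g c x ξ n - riemannSum B f g c y η m‖ₑ ≤
      ‖B‖ₑ * ε * powVarOn 1 g univ := by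
  -- the increment of `g` over `[x_i, x_{i+1}] ∩ [y_j, y_{j+1}]`
  let Δ : ℕ → ℕ → V := fun i j =>
    g (max (x i) (min (x (i + 1)) (y (j + 1)))) - g (max (x i) (min (x (i + 1)) (y j)))
  have e1 : riemannSum B f g c x ξ n =
      ∑ i ∈ Finset.range n, ∑ j ∈ Finset.range m, B (f (ξ i) - c) (Δ i j) := by
    refine Finset.sum_congr rfl fun i hi => ?_
    have hi' := Finset.mem_range.1 hi
    rw [← map_sum, sum_sub_clip g (hx (Nat.le_succ i)) (h0 ▸ hx (Nat.zero_le i))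
      (h1 ▸ hx (Nat.succ_le_of_lt hi'))]
  have e2 : riemannSum B f g c y η m =
      ∑ i ∈ Finset.range n, ∑ j ∈ Finset.range m, B (f (η j) - c) (Δ i j) := by
    rw [Finset.sum_comm]
    refine Finset.sum_congr rfl fun j hj => ?_
    have hj' := Finset.mem_range.1 hj
    rw [← map_sum]
    congr 1
    rw [← sum_sub_clip g (hy (Nat.le_succ j)) (h0 ▸ hy (Nat.zero_le j))
      (h1 ▸ hy (Nat.succ_le_of_lt hj'))]
    exact Finset.sum_congr rfl fun i _ =>
      (sub_clip_comm g (hx (Nat.le_succ i)) (hy (Nat.le_succ j))).symm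
  have e3 : riemannSum B f g c x ξ n - riemannSum B f g c y η m =
      ∑ i ∈ Finset.range n, ∑ j ∈ Finset.range m, B (f (ξ i) - f (η j)) (Δ i j) := by
    rw [e1, e2, ← Finset.sum_sub_distrib]
    refine Finset.sum_congr rfl fun i _ => ?_
    rw [← Finset.sum_sub_distrib]
    refine Finset.sum_congr rfl fun j _ => ?_
    simp only [map_sub, sub_apply]
    abel
  rw [e3]
  calc _ ≤ ∑ i ∈ Finset.range n, ∑ j ∈ Finset.range m, ‖B (f (ξ i) - f (η j)) (Δ i j)‖ₑ :=
        (enorm_sum_le _ _).trans (Finset.sum_le_sum fun i _ => enorm_sum_le _ _)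
    _ ≤ ∑ i ∈ Finset.range n, ∑ j ∈ Finset.range m, ‖B‖ₑ * ε * ‖Δ i j‖ₑ ^ (1 : ℝ) := by
        refine Finset.sum_le_sum fun i hi => Finset.sum_le_sum fun j hj => ?_
        rw [ENNReal.rpow_one]
        by_cases hov : x i ≤ y (j + 1) ∧ y j ≤ x (i + 1)
        · refine (enorm_apply_apply_le B _ _).trans ?_
          gcongr
          exact hclose i (Finset.mem_range.1 hi) j (Finset.mem_range.1 hj) hov.1 hov.2
        · have : Δ i j = 0 := sub_clip_eq_zero g (hy (Nat.le_succ j)) hov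
          simp [this]
    _ ≤ ∑ i ∈ Finset.range n, ‖B‖ₑ * ε * powVarOn 1 g (Icc (x i) (x (i + 1))) := by
        refine Finset.sum_le_sum fun i _ => ?_
        rw [← Finset.mul_sum]
        gcongr
        refine sum_le_powVarOn 1 g (u := fun j => max (x i) (min (x (i + 1)) (y j))) ?_ ?_ m
        · exact fun j k hjk => max_le_max le_rfl (min_le_min le_rfl (hy hjk))
        · exact fun j => ⟨le_max_left _ _, max_le (hx (Nat.le_succ i)) (min_le_left _ _)⟩
    _ ≤ ‖B‖ₑ * ε * powVarOn 1 g univ := by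
        rw [← Finset.mul_sum]
        gcongr
        exact (sum_powVarOn_Icc_le 1 g hx n).trans (powVarOn_mono 1 g (subset_univ _))

end Overlap

/-! ### Existence of the Riemann-Stieltjes integral -/

section Integral

variable {T : ℝ} {V : Type*} [NormedAddCommGroup V] [NormedSpace ℝ V]
  {E : Type*} [NormedAddCommGroup E] [NormedSpace ℝ E]

/-- `x` is a monotone sequence from `s` to `t` in `n` steps of length at most `δ`, with
intermediate points `ξ`. In contrast to a `Partition`, it may have repetitions. -/
structure IsFineChain (x ξ : ℕ → Icc (0 : ℝ) T) (n : ℕ) (s t : Icc (0 : ℝ) T) (δ : ℝ) :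
    Prop where
  mono : Monotone x
  first : x 0 = s
  last : x n = t
  tag : ∀ i < n, x i ≤ ξ i ∧ ξ i ≤ x (i + 1)
  step : ∀ i < n, (x (i + 1) : ℝ) - x i ≤ δ

theorem exists_riemannSum_sub_le (B : V →L[ℝ] V →L[ℝ] E) (f g : C(Icc (0 : ℝ) T, V))
    (hg : powVarOn 1 g univ < ∞) {ε : ℝ} (hε : 0 < ε) :
    ∃ δ > 0, ∀ (c : V) (s t : Icc (0 : ℝ) T) (x ξ y η : ℕ → Icc (0 : ℝ) T) (n m : ℕ),
      IsFineChain x ξ n s t δ → IsFineChain y η m s t δ →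
        ‖riemannSum B f g c x ξ n - riemannSum B f g c y η m‖ ≤ ε := by
  obtain ⟨K, hK⟩ : ∃ K : ℝ≥0, powVarOn 1 g univ = K := ⟨_, (ENNReal.coe_toNNReal hg.ne).symm⟩
  have hf : UniformContinuous f := CompactSpace.uniformContinuous_of_continuous f.continuous
  have hpos : 0 < ε / (‖B‖ * K + 1) := by positivity
  obtain ⟨δ, hδ, hfδ⟩ := Metric.uniformContinuous_iff.1 hf _ hpos
  -- Tags of overlapping intervals of length at most `δ / 3` are at distance at most `2 δ / 3`.
  refine ⟨δ / 3, by positivity, fun c s t x ξ y η n m hx hy => ?_⟩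
  have key := enorm_riemannSum_sub_le B f g c (ξ := ξ) (η := η) hx.mono hy.mono
    (hx.first.trans hy.first.symm) (hx.last.trans hy.last.symm)
    (ε := ENNReal.ofReal (ε / (‖B‖ * K + 1))) (fun i hi j hj h1 h2 => by
      rw [← ofReal_norm]
      refine ENNReal.ofReal_le_ofReal ?_
      rw [← dist_eq_norm]
      refine (hfδ ?_).le
      have a1 : (x i : ℝ) ≤ ξ i := (hx.tag i hi).1
      have a2 : (ξ i : ℝ) ≤ x (i + 1) := (hx.tag i hi).2
      have b1 : (y j : ℝ) ≤ η j := (hy.tag j hj).1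
      have b2 : (η j : ℝ) ≤ y (j + 1) := (hy.tag j hj).2
      have a3 := hx.step i hi
      have b3 := hy.step j hj
      have h1' : (x i : ℝ) ≤ y (j + 1) := h1
      have h2' : (y j : ℝ) ≤ x (i + 1) := h2
      rw [Subtype.dist_eq, Real.dist_eq, abs_lt]
      constructor <;> linarith)
  rw [hK, ← ofReal_norm, ← ofReal_norm, ← ENNReal.ofReal_coe_nnreal,
    ← ENNReal.ofReal_mul (norm_nonneg _), ← ENNReal.ofReal_mul (by positivity),
    ENNReal.ofReal_le_ofReal_iff (by positivity)] at key
  refine key.trans ?_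
  have : ‖B‖ * (ε / (‖B‖ * K + 1)) * K = ε * ((‖B‖ * K) / (‖B‖ * K + 1)) := by ring
  rw [this]
  refine mul_le_of_le_one_right hε.le ((div_le_one (by positivity)).2 (by linarith))

/-- The points `i T / (n + 1)` of the uniform grid, clipped to `[s, t]`. -/
noncomputable def clipGrid (s t : Icc (0 : ℝ) T) (n i : ℕ) : Icc (0 : ℝ) T :=
  ⟨max s (min t (T * i / (n + 1))), le_max_of_le_left s.2.1,
    max_le s.2.2 ((min_le_left _ _).trans t.2.2)⟩

theorem clipGrid_mono (s t : Icc (0 : ℝ) T) (n : ℕ) : Monotone (clipGrid s t n) := by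
  intro i j hij
  have hT : 0 ≤ T := s.2.1.trans s.2.2
  refine Subtype.coe_le_coe.1 (max_le_max le_rfl (min_le_min le_rfl ?_))
  gcongr

theorem clipGrid_zero (s t : Icc (0 : ℝ) T) (n : ℕ) : clipGrid s t n 0 = s :=
  Subtype.ext (by simp [clipGrid, t.2.1, s.2.1])

theorem clipGrid_last {s t : Icc (0 : ℝ) T} (hst : s ≤ t) (n : ℕ) :
    clipGrid s t n (n + 1) = t := by
  refine Subtype.ext ?_
  have h : T * ((n + 1 : ℕ) : ℝ) / (n + 1) = T := by
    push_cast
    field_simp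
  simp only [clipGrid]
  rw [h, min_eq_left t.2.2, max_eq_right (Subtype.coe_le_coe.2 hst)]

theorem isFineChain_clipGrid {s t : Icc (0 : ℝ) T} (hst : s ≤ t) (n : ℕ) :
    IsFineChain (clipGrid s t n) (clipGrid s t n) (n + 1) s t (T / (n + 1)) where
  mono := clipGrid_mono s t n
  first := clipGrid_zero s t n
  last := clipGrid_last hst n
  tag i _ := ⟨le_rfl, clipGrid_mono s t n (Nat.le_succ i)⟩
  step i _ := by
    have hT : 0 ≤ T := s.2.1.trans s.2.2
    have h : T * ((i + 1 : ℕ) : ℝ) / (n + 1) = T * i / (n + 1) + T / (n + 1) := by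
      push_cast
      ring
    have hpos : 0 ≤ T / ((n : ℝ) + 1) := by positivity
    simp only [clipGrid]
    rw [h, sub_le_iff_le_add]
    refine max_le (by linarith [le_max_left (s : ℝ) (min t (T * i / (n + 1)))]) ?_
    rcases le_total (t : ℝ) (T * i / (n + 1)) with h' | h'
    · have := le_max_right (s : ℝ) (min t (T * i / (n + 1)))
      rw [min_eq_left h'] at this ⊢
      exact (min_le_left _ _).trans (by linarith)
    · have := le_max_right (s : ℝ) (min t (T * i / (n + 1)))
      rw [min_eq_right h'] at this ⊢
      exact (min_le_right _ _).trans (by linarith)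

theorem continuous_clipGrid (n i : ℕ) :
    Continuous fun q : Icc (0 : ℝ) T × Icc (0 : ℝ) T => clipGrid q.1 q.2 n i := by
  unfold clipGrid
  fun_prop

theorem IsFineChain.mono_step {x ξ : ℕ → Icc (0 : ℝ) T} {n : ℕ} {s t : Icc (0 : ℝ) T}
    {δ δ' : ℝ} (h : IsFineChain x ξ n s t δ) (hδ : δ ≤ δ') : IsFineChain x ξ n s t δ' :=
  ⟨h.mono, h.first, h.last, h.tag, fun i hi => (h.step i hi).trans hδ⟩

theorem eventually_div_le {δ : ℝ} (hδ : 0 < δ) (T : ℝ) :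
    ∀ᶠ n : ℕ in atTop, T / ((n : ℝ) + 1) ≤ δ := by
  have h : Tendsto (fun n : ℕ => T / ((n : ℝ) + 1)) atTop (𝓝 0) :=
    tendsto_const_nhds.div_atTop
      (tendsto_atTop_add_const_right _ _ tendsto_natCast_atTop_atTop)
  exact (h.eventually_lt_const hδ).mono fun n hn => hn.le

theorem Partition.dist_le {a b : ℝ} (D : Partition T a b) {δ : ℝ} (hD : (D.mesh : ℝ) ≤ δ) {i : ℕ}
    (hi : i < D.n) : dist (D.pts (i + 1)) (D.pts i) ≤ δ := by
  have h : nndist (D.pts i) (D.pts (i + 1)) ≤ D.mesh :=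
    Finset.le_sup (f := fun i => nndist (D.pts i) (D.pts (i + 1))) (Finset.mem_range.2 hi)
  rw [dist_comm]
  exact (NNReal.coe_le_coe.2 h).trans hD

theorem Partition.isFineChain {s t : Icc (0 : ℝ) T} (D : Partition T s t) {δ : ℝ}
    (hD : (D.mesh : ℝ) ≤ δ) {ξ : ℕ → Icc (0 : ℝ) T}
    (hξ : ∀ i < D.n, D.pts i ≤ ξ i ∧ ξ i ≤ D.pts (i + 1)) :
    IsFineChain (fun i => D.pts (min i D.n)) ξ D.n s t δ where
  mono := D.monotone
  first := by simpa using Subtype.ext D.first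
  last := by simpa using Subtype.ext D.last
  tag i hi := by simpa only [min_eq_left hi.le, min_eq_left (Nat.succ_le_of_lt hi)] using hξ i hi
  step i hi := by
    simp only [min_eq_left hi.le, min_eq_left (Nat.succ_le_of_lt hi)]
    have h := D.dist_le hD hi
    rw [Subtype.dist_eq, Real.dist_eq] at h
    exact (le_abs_self _).trans h

theorem Partition.riemannSum_eq {s t : Icc (0 : ℝ) T} (D : Partition T s t)
    (B : V →L[ℝ] V →L[ℝ] E) (f g : Icc (0 : ℝ) T → V) (c : V) (ξ : ℕ → Icc (0 : ℝ) T) :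
    riemannSum B f g c (fun i => D.pts (min i D.n)) ξ D.n =
      ∑ i ∈ Finset.range D.n, B (f (ξ i) - c) (g (D.pts (i + 1)) - g (D.pts i)) := by
  refine Finset.sum_congr rfl fun i hi => ?_
  have hi' := Finset.mem_range.1 hi
  simp only [min_eq_left hi'.le, min_eq_left (Nat.succ_le_of_lt hi')]

theorem exists_partition_mesh_le {s t : Icc (0 : ℝ) T} (hst : s ≤ t) {δ : ℝ} (hδ : 0 < δ) :
    ∃ D : Partition T s t, (D.mesh : ℝ) ≤ δ := by
  obtain ⟨n, hn⟩ := (eventually_div_le hδ T).exists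
  have hc := isFineChain_clipGrid hst n
  obtain ⟨D, -, hD⟩ := exists_partition_sum_eq (fun _ _ => (0 : ℝ)) (fun _ => rfl) hc.mono (n + 1)
  refine ⟨⟨D.n, D.pts, D.first.trans (congrArg _ hc.first),
    D.last.trans (congrArg _ hc.last), D.lt_succ⟩, ?_⟩
  rw [← NNReal.coe_mk δ hδ.le, NNReal.coe_le_coe]
  refine Finset.sup_le fun i hi => ?_
  obtain ⟨j, hj, h1, h2⟩ := hD i (Finset.mem_range.1 hi)
  rw [← NNReal.coe_le_coe, coe_nndist, h1, h2, dist_comm, Subtype.dist_eq, Real.dist_eq,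
    abs_of_nonneg (sub_nonneg.2 (Subtype.coe_le_coe.2 (hc.mono (Nat.le_succ j))))]
  exact (hc.step j hj).trans hn

theorem HasRSIntegral.unique {W F : Type*} [NormedAddCommGroup W] [NormedAddCommGroup F]
    {B : W → W → F} {f g : Icc (0 : ℝ) T → W} {s t : Icc (0 : ℝ) T}
    (hst : s ≤ t) {L L' : F} (h : HasRSIntegral B f g s t L) (h' : HasRSIntegral B f g s t L') :
    L = L' := by
  refine eq_of_forall_dist_le fun ε hε => ?_
  obtain ⟨δ, hδ, hL⟩ := h (ε / 2) (by positivity)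
  obtain ⟨δ', hδ', hL'⟩ := h' (ε / 2) (by positivity)
  obtain ⟨D, hD⟩ := exists_partition_mesh_le hst (lt_min hδ hδ')
  have tag : ∀ i < D.n, D.pts i ≤ D.pts i ∧ D.pts i ≤ D.pts (i + 1) :=
    fun i hi => ⟨le_rfl, (D.lt_succ i hi).le⟩
  have a := hL D (hD.trans (min_le_left _ _)) D.pts tag
  have b := hL' D (hD.trans (min_le_right _ _)) D.pts tag
  rw [← dist_eq_norm] at a b
  linarith [dist_triangle_left L L' (∑ i ∈ Finset.range D.n,
    B (f (D.pts i)) (g (D.pts (i + 1)) - g (D.pts i)))]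

/-- The left Riemann sum of `∫_s^t B(f(u) - f(s), dg(u))` along the clipped uniform grid. -/
noncomputable def gridSum (B : V →L[ℝ] V →L[ℝ] E) (f g : Icc (0 : ℝ) T → V) (n : ℕ)
    (s t : Icc (0 : ℝ) T) : E :=
  riemannSum B f g (f s) (clipGrid s t n) (clipGrid s t n) (n + 1)

/-- If `f` is continuous and `g` of bounded variation, the integrals `∫_s^t B(f(u) - f(s), dg(u))`
exist, and the Riemann sums along the clipped uniform grids converge to them uniformly
in `s ≤ t`. -/
theorem tendstoUniformlyOn_gridSum [CompleteSpace E] (B : V →L[ℝ] V →L[ℝ] E)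
    (f g : C(Icc (0 : ℝ) T, V)) (hg : powVarOn 1 g univ < ∞) :
    TendstoUniformlyOn (fun n (q : Icc (0 : ℝ) T × Icc (0 : ℝ) T) => gridSum B f g n q.1 q.2)
      (fun q => rsIntegral (fun v w => B v w) (fun u => f u - f q.1) g q.1 q.2) atTop
      {q | q.1 ≤ q.2} := by
  have hcauchy : ∀ ε > 0, ∃ N : ℕ, ∀ m ≥ N, ∀ n ≥ N, ∀ s t : Icc (0 : ℝ) T, s ≤ t →
      dist (gridSum B f g m s t) (gridSum B f g n s t) ≤ ε := by
    intro ε hε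
    obtain ⟨δ, hδ, h⟩ := exists_riemannSum_sub_le B f g hg hε
    obtain ⟨N, hN⟩ := eventually_atTop.1 (eventually_div_le hδ T)
    refine ⟨N, fun m hm n hn s t hst => ?_⟩
    rw [dist_eq_norm]
    exact h _ s t _ _ _ _ _ _ ((isFineChain_clipGrid hst m).mono_step (hN m hm))
      ((isFineChain_clipGrid hst n).mono_step (hN n hn))
  have hlim : ∀ s t : Icc (0 : ℝ) T, s ≤ t → ∃ L, Tendsto (fun n => gridSum B f g n s t)
      atTop (𝓝 L) := by
    intro s t hst
    refine cauchySeq_tendsto_of_complete (Metric.cauchySeq_iff.2 fun ε hε => ?_)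
    obtain ⟨N, hN⟩ := hcauchy (ε / 2) (by positivity)
    exact ⟨N, fun m hm n hn => (hN m hm n hn s t hst).trans_lt (by linarith)⟩
  have hint : ∀ s t : Icc (0 : ℝ) T, s ≤ t → Tendsto (fun n => gridSum B f g n s t) atTop
      (𝓝 (rsIntegral (fun v w => B v w) (fun u => f u - f s) g s t)) := by
    intro s t hst
    obtain ⟨L, hL⟩ := hlim s t hst
    have hRS : HasRSIntegral (fun v w => B v w) (fun u => f u - f s) g s t L := by
      intro ε hε
      obtain ⟨δ, hδ, h⟩ := exists_riemannSum_sub_le B f g hg (half_pos hε)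
      refine ⟨δ, hδ, fun D hD ξ hξ => ?_⟩
      refine lt_of_le_of_lt ?_ (half_lt_self hε)
      rw [← D.riemannSum_eq B f g (f s) ξ]
      refine le_of_tendsto (tendsto_const_nhds.sub hL).norm ?_
      filter_upwards [eventually_div_le hδ T] with n hn
      exact h _ s t _ _ _ _ _ _ (D.isFineChain hD hξ) ((isFineChain_clipGrid hst n).mono_step hn)
    have hex : ∃ L, HasRSIntegral (fun v w => B v w) (fun u => f u - f s) g s t L := ⟨L, hRS⟩
    -- `rsIntegral` is a chosen integral, which equals `L` by uniqueness.
    rwa [rsIntegral, dif_pos hex, hex.choose_spec.unique hst hRS]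
  rw [Metric.tendstoUniformlyOn_iff]
  intro ε hε
  obtain ⟨N, hN⟩ := hcauchy (ε / 2) (by positivity)
  filter_upwards [eventually_ge_atTop N] with n hn q hq
  refine lt_of_le_of_lt ?_ (half_lt_self hε)
  refine le_of_tendsto ((hint q.1 q.2 hq).dist tendsto_const_nhds) ?_
  filter_upwards [eventually_ge_atTop N] with m hm
  exact hN m hm n hn q.1 q.2 hq

theorem tendsto_gridSum [CompleteSpace E] (B : V →L[ℝ] V →L[ℝ] E)
    (f g : C(Icc (0 : ℝ) T, V)) (hg : powVarOn 1 g univ < ∞) {s t : Icc (0 : ℝ) T} (hst : s ≤ t) :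
    Tendsto (fun n => gridSum B f g n s t) atTop
      (𝓝 (rsIntegral (fun v w => B v w) (fun u => f u - f s) g s t)) :=
  (tendstoUniformlyOn_gridSum B f g hg).tendsto_at (x := (s, t)) hst

end Integral

/-! ### Vanishing variation of paths of bounded variation -/

section Vanishing

variable {T : ℝ} {E : Type*} [NormedAddCommGroup E]

theorem exists_dist_le_enorm_sub_le (f : C(Icc (0 : ℝ) T, E)) {ε : ℝ≥0} (hε : 0 < ε) :
    ∃ δ > 0, ∀ a b, dist a b ≤ δ → ‖f a - f b‖ₑ ≤ ε := by
  have hf : UniformContinuous f := CompactSpace.uniformContinuous_of_continuous f.continuous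
  obtain ⟨δ, hδ, h⟩ := Metric.uniformContinuous_iff.1 hf ε hε
  refine ⟨δ / 2, by positivity, fun a b hab => ?_⟩
  have h1 := (h (hab.trans_lt (half_lt_self hδ))).le
  rw [dist_eq_norm] at h1
  exact ENNReal.coe_le_coe.2 (NNReal.coe_le_coe.1 h1)

theorem vanishingVar_of_forall_exists {p : ℝ} (hp : 0 < p)
    {α : Icc (0 : ℝ) T → Icc (0 : ℝ) T → E} {K : ℝ≥0∞} (hK : K < ∞)
    (h : ∀ ε : ℝ≥0, 0 < ε → ∃ δ > 0, ∀ D : Partition T 0 T, (D.mesh : ℝ) ≤ δ →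
      powSum p α D ≤ ε * K) : VanishingVar p α := by
  rw [VanishingVar, ENNReal.tendsto_nhds_zero]
  intro η hη
  obtain ⟨ε, hε, hεK⟩ := ENNReal.exists_nnreal_pos_mul_lt hK.ne
    (ENNReal.rpow_pos_of_nonneg hη hp.le).ne'
  obtain ⟨δ, hδ, hD⟩ := h ε hε
  filter_upwards [Ioc_mem_nhdsGT hδ] with δ' hδ'
  rw [modVar_le_iff hp]
  exact fun D hmesh => (hD D (hmesh.trans hδ'.2)).trans hεK.le

theorem sum_rpow_le_mul_sum_rpow {ι : Type*} (s : Finset ι) (x : ι → ℝ≥0∞) {p q : ℝ}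
    (hp : 0 ≤ p) (hpq : p ≤ q) {ε : ℝ≥0∞} (h : ∀ i ∈ s, x i ≤ ε) :
    ∑ i ∈ s, x i ^ q ≤ ε ^ (q - p) * ∑ i ∈ s, x i ^ p := by
  rw [Finset.mul_sum]
  refine Finset.sum_le_sum fun i hi => ?_
  calc x i ^ q = x i ^ (q - p) * x i ^ p := by
        rw [← ENNReal.rpow_add_of_nonneg _ _ (sub_nonneg.2 hpq) hp, sub_add_cancel]
    _ ≤ ε ^ (q - p) * x i ^ p := by
        gcongr
        exact h i hi

theorem add_mem_CpVar {g g' : C(Icc (0 : ℝ) T, E)} {p : ℝ} (hp : 1 ≤ p) (hg : g ∈ CpVar E T p)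
    (hg' : g' ∈ CpVar E T p) :
    g + g' ∈ CpVar E T p := by
  change pVar p (increment (g + g')) < ∞
  rw [increment_add]
  exact (pVar_add_le hp _ _).trans_lt (ENNReal.add_lt_top.2 ⟨hg, hg'⟩)

theorem sub_mem_CpVar {g g' : C(Icc (0 : ℝ) T, E)} {p : ℝ} (hp : 1 ≤ p) (hg : g ∈ CpVar E T p)
    (hg' : g' ∈ CpVar E T p) :
    g - g' ∈ CpVar E T p := by
  change pVar p (increment (g - g')) < ∞
  rw [increment_sub, sub_eq_add_neg]
  refine (pVar_add_le hp _ _).trans_lt (ENNReal.add_lt_top.2 ⟨hg, ?_⟩)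
  rw [pVar_neg]
  exact hg'

theorem vanishingVar_two_of_mem_CpVar_one {γ : C(Icc (0 : ℝ) T, E)} (hγ : γ ∈ CpVar E T 1) :
    VanishingVar 2 (increment γ) := by
  refine vanishingVar_of_forall_exists two_pos ((mem_CpVar_iff one_pos γ).1 hγ) fun ε hε => ?_
  obtain ⟨δ, hδ, h⟩ := exists_dist_le_enorm_sub_le γ hε
  refine ⟨δ, hδ, fun D hD => ?_⟩
  refine (sum_rpow_le_mul_sum_rpow _ _ zero_le_one one_le_two (ε := ε) fun i hi =>
    h _ _ (D.dist_le hD (Finset.mem_range.1 hi))).trans ?_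
  rw [show (2 : ℝ) - 1 = 1 by norm_num, ENNReal.rpow_one, ← iSup_powSum_increment one_pos]
  gcongr
  exact le_iSup (fun D : Partition T 0 T => powSum 1 (increment γ) D) D

end Vanishing

/-! ### The area of paths of bounded variation -/

section Area

variable {V : Type*} [NormedAddCommGroup V] [NormedSpace ℝ V] {T : ℝ}
  {E : Type*} [NormedAddCommGroup E] [NormedSpace ℝ E]

theorem enorm_half_smul_le {F : Type*} [NormedAddCommGroup F] [NormedSpace ℝ F]
    (x : F) :
    ‖(1 / 2 : ℝ) • x‖ₑ ≤ ‖x‖ₑ := by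
  rw [enorm_smul]
  refine mul_le_of_le_one_left zero_le ?_
  rw [← ofReal_norm, ENNReal.ofReal_le_one]
  norm_num

/-- The area with a bounded bilinear map `B` in place of the bracket. -/
noncomputable def bilinArea (B : V →L[ℝ] V →L[ℝ] E) (f g : C(Icc (0 : ℝ) T, V))
    (s t : Icc (0 : ℝ) T) : E :=
  (1 / 2 : ℝ) • rsIntegral (fun v w => B v w) (fun u => f u - f s) g s t

variable [CompleteSpace E] (B : V →L[ℝ] V →L[ℝ] E) (f f' : C(Icc (0 : ℝ) T, V))
  {g g' : C(Icc (0 : ℝ) T, V)}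

theorem tendsto_bilinArea (hg : g ∈ CpVar V T 1) {s t : Icc (0 : ℝ) T} (hst : s ≤ t) :
    Tendsto (fun n => (1 / 2 : ℝ) • gridSum B f g n s t) atTop
      (𝓝 (bilinArea B f g s t)) :=
  (tendsto_gridSum _ f g ((mem_CpVar_iff one_pos g).1 hg) hst).const_smul _

theorem bilinArea_add_left (hg : g ∈ CpVar V T 1) {s t : Icc (0 : ℝ) T} (hst : s ≤ t) :
    bilinArea B (f + f') g s t = bilinArea B f g s t + bilinArea B f' g s t := by
  refine tendsto_nhds_unique (tendsto_bilinArea B (f + f') hg hst)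
    (((tendsto_bilinArea B f hg hst).add (tendsto_bilinArea B f' hg hst)).congr fun n => ?_)
  rw [← smul_add, gridSum, gridSum, gridSum, riemannSum, riemannSum, riemannSum,
    ← Finset.sum_add_distrib]
  congr 1
  refine Finset.sum_congr rfl fun i _ => ?_
  rw [← add_apply, ← map_add, ContinuousMap.add_apply, ContinuousMap.add_apply,
    add_sub_add_comm]

theorem bilinArea_add_right (hg : g ∈ CpVar V T 1) (hg' : g' ∈ CpVar V T 1)
    {s t : Icc (0 : ℝ) T} (hst : s ≤ t) :
    bilinArea B f (g + g') s t = bilinArea B f g s t + bilinArea B f g' s t := by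
  refine tendsto_nhds_unique (tendsto_bilinArea B f (add_mem_CpVar le_rfl hg hg') hst)
    (((tendsto_bilinArea B f hg hst).add (tendsto_bilinArea B f hg' hst)).congr fun n => ?_)
  rw [← smul_add, gridSum, gridSum, gridSum, riemannSum, riemannSum, riemannSum,
    ← Finset.sum_add_distrib]
  congr 1
  refine Finset.sum_congr rfl fun i _ => ?_
  rw [← map_add, ContinuousMap.add_apply, ContinuousMap.add_apply, add_sub_add_comm]

theorem bilinArea_sub_left (hg : g ∈ CpVar V T 1) {s t : Icc (0 : ℝ) T} (hst : s ≤ t) :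
    bilinArea B (f - f') g s t = bilinArea B f g s t - bilinArea B f' g s t := by
  rw [eq_sub_iff_add_eq, ← bilinArea_add_left B _ _ hg hst, sub_add_cancel]

theorem bilinArea_sub_right (hg : g ∈ CpVar V T 1) (hg' : g' ∈ CpVar V T 1)
    {s t : Icc (0 : ℝ) T} (hst : s ≤ t) :
    bilinArea B f (g - g') s t = bilinArea B f g s t - bilinArea B f g' s t := by
  rw [eq_sub_iff_add_eq, ← bilinArea_add_right B f (sub_mem_CpVar le_rfl hg hg') hg' hst,
    sub_add_cancel]

theorem clipGrid_mem {s t : Icc (0 : ℝ) T} (hst : s ≤ t) (n i : ℕ) :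
    clipGrid s t n i ∈ Icc s t :=
  ⟨le_max_left (s : ℝ) _, max_le (Subtype.coe_le_coe.2 hst) (min_le_left (t : ℝ) _)⟩

/-- Young's inequality on `[s, t]`. -/
theorem enorm_bilinArea_le_young (hg : g ∈ CpVar V T 1) {p q : ℝ} (hp : 0 < p) (hq : 0 < q)
    {s t : Icc (0 : ℝ) T} (hst : s ≤ t) :
    ‖bilinArea B f g s t‖ₑ ≤ youngConst (1 / p + 1 / q) * (‖B‖ₑ *
      (powVarOn p f (Icc s t) ^ (1 / p) * powVarOn q g (Icc s t) ^ (1 / q))) := by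
  refine le_of_tendsto (tendsto_bilinArea B f hg hst).enorm (Eventually.of_forall fun n => ?_)
  refine (enorm_half_smul_le _).trans ?_
  have h := enorm_sum_le_youngConst B f g hp hq n (clipGrid_mono s t n)
    (clipGrid_mem hst n)
  rwa [clipGrid_zero] at h

theorem pVar_one_bilinArea_le (hg : g ∈ CpVar V T 1) {p q : ℝ} (hp : 0 < p) (hq : 0 < q)
    (hpq : 1 ≤ 1 / p + 1 / q) :
    pVar 1 (bilinArea B f g) ≤ youngConst (1 / p + 1 / q) * (‖B‖ₑ *
      (pVar p (increment f) * pVar q (increment g))) := by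
  rw [pVar_le_iff one_pos]
  intro D
  have hle : ∀ (r : ℝ) (_ : 0 < r) (h : C(Icc (0 : ℝ) T, V)),
      (∑ i ∈ Finset.range D.n,
        (powVarOn r h (Icc (D.pts (min i D.n)) (D.pts (min (i + 1) D.n))) ^ (1 / r)) ^ r) ^ (1 / r)
      ≤ pVar r (increment h) := by
    intro r hr h
    rw [pVar_increment hr]
    refine ENNReal.rpow_le_rpow ?_ (one_div_pos.2 hr).le
    refine le_trans (le_of_eq (Finset.sum_congr rfl fun i _ => ?_))
      ((sum_powVarOn_Icc_le r h D.monotone D.n).trans (powVarOn_mono r h (subset_univ _)))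
    rw [← ENNReal.rpow_mul, one_div_mul_cancel hr.ne', ENNReal.rpow_one]
  rw [ENNReal.rpow_one]
  calc powSum 1 (bilinArea B f g) D
      ≤ ∑ i ∈ Finset.range D.n, youngConst (1 / p + 1 / q) * (‖B‖ₑ *
          (powVarOn p f (Icc (D.pts (min i D.n)) (D.pts (min (i + 1) D.n))) ^ (1 / p) *
            powVarOn q g (Icc (D.pts (min i D.n)) (D.pts (min (i + 1) D.n))) ^ (1 / q))) := by
        refine Finset.sum_le_sum fun i hi => ?_
        have hi' := Finset.mem_range.1 hi
        rw [ENNReal.rpow_one, min_eq_left hi'.le, min_eq_left (Nat.succ_le_of_lt hi')]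
        exact enorm_bilinArea_le_young B f hg hp hq (D.lt_succ i hi').le
    _ ≤ _ := by
        rw [← Finset.mul_sum, ← Finset.mul_sum]
        gcongr
        refine (sum_mul_le_of_one_le _ _ _ hp hq hpq).trans ?_
        gcongr
        · exact hle p hp f
        · exact hle q hq g

theorem enorm_bilinArea_le (hg : g ∈ CpVar V T 1) {s t : Icc (0 : ℝ) T} (hst : s ≤ t)
    {ε : ℝ≥0∞} (hε : ∀ u ∈ Icc s t, ‖f u - f s‖ₑ ≤ ε) :
    ‖bilinArea B f g s t‖ₑ ≤ ‖B‖ₑ * ε * powVarOn 1 g (Icc s t) := by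
  refine le_of_tendsto (tendsto_bilinArea B f hg hst).enorm (Eventually.of_forall fun n => ?_)
  refine (enorm_half_smul_le _).trans ?_
  rw [gridSum, riemannSum]
  refine (enorm_sum_le _ _).trans ?_
  refine le_trans ?_ (mul_le_mul_right (sum_le_powVarOn 1 g (clipGrid_mono s t n)
    (clipGrid_mem hst n) (n + 1)) _)
  rw [Finset.mul_sum]
  refine Finset.sum_le_sum fun i _ => ?_
  rw [ENNReal.rpow_one]
  refine (enorm_apply_apply_le _ _ _).trans ?_
  gcongr
  exact hε _ (clipGrid_mem hst n i)

theorem vanishingVar_bilinArea_self {γ : C(Icc (0 : ℝ) T, V)} (hγ : γ ∈ CpVar V T 1) :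
    VanishingVar 1 (bilinArea B γ γ) := by
  have hV := (mem_CpVar_iff one_pos γ).1 hγ
  refine vanishingVar_of_forall_exists one_pos
    (K := ‖B‖ₑ * powVarOn 1 γ univ) (ENNReal.mul_lt_top enorm_lt_top hV) fun ε hε => ?_
  obtain ⟨δ, hδ, h⟩ := exists_dist_le_enorm_sub_le γ hε
  refine ⟨δ, hδ, fun D hD => ?_⟩
  have hsum := (sum_powVarOn_Icc_le 1 γ D.monotone D.n).trans (powVarOn_mono 1 γ (subset_univ _))
  rw [mul_left_comm, ← mul_assoc]
  refine le_trans ?_ (mul_le_mul_right hsum _)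
  rw [Finset.mul_sum]
  refine Finset.sum_le_sum fun i hi => ?_
  have hi' := Finset.mem_range.1 hi
  rw [ENNReal.rpow_one]
  simp only [min_eq_left hi'.le, min_eq_left (Nat.succ_le_of_lt hi')]
  refine enorm_bilinArea_le B γ hγ (D.lt_succ i hi').le fun u hu => h _ _ ?_
  refine le_trans ?_ (D.dist_le hD hi')
  rw [Subtype.dist_eq, Subtype.dist_eq, Real.dist_eq, Real.dist_eq]
  have h1 : (D.pts i : ℝ) ≤ u := hu.1
  have h2 : (u : ℝ) ≤ D.pts (i + 1) := hu.2
  rw [abs_of_nonneg (by linarith), abs_of_nonneg (by linarith)]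
  linarith

theorem isTriangleFun_bilinArea (hg : g ∈ CpVar V T 1) : IsTriangleFun (bilinArea B f g) := by
  constructor
  · have h := (tendstoUniformlyOn_gridSum B f g
      ((mem_CpVar_iff one_pos g).1 hg)).continuousOn (Frequently.of_forall fun n => by
        refine Continuous.continuousOn ?_
        unfold gridSum riemannSum
        have := fun i => continuous_clipGrid (T := T) n i
        fun_prop)
    exact h.const_smul (1 / 2 : ℝ)
  · intro t
    refine tendsto_nhds_unique (tendsto_bilinArea B f hg le_rfl)
      (tendsto_const_nhds.congr fun n => ?_)
    have hc : ∀ i, clipGrid t t n i = t := fun i =>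
      le_antisymm (clipGrid_mem le_rfl n i).2 (clipGrid_mem le_rfl n i).1
    simp [gridSum, riemannSum, hc]

end Area

/-! ### Interpolation between variation norms -/

section Interpolation

variable {T : ℝ} {E : Type*} [NormedAddCommGroup E]

theorem powVarOn_le_mul_powVarOn {X : Type*} [LinearOrder X] (f : X → E) (S : Set X) {p q : ℝ}
    (hp : 0 ≤ p) (hpq : p ≤ q) {ε : ℝ≥0∞} (h : ∀ a b, a ≤ b → ‖f b - f a‖ₑ ≤ ε) :
    powVarOn q f S ≤ ε ^ (q - p) * powVarOn p f S := by
  refine iSup_le ?_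
  rintro ⟨n, u, hu, hS⟩
  refine (sum_rpow_le_mul_sum_rpow _ _ hp hpq fun i _ => h _ _ (hu (Nat.le_succ i))).trans ?_
  gcongr
  exact sum_le_powVarOn p f hu hS n

theorem CpVar_subset {p q : ℝ} (hp : 0 < p) (hpq : p ≤ q) : CpVar E T p ⊆ CpVar E T q := by
  intro γ hγ
  have hγ' : pVar p (increment γ) < ∞ := hγ
  rw [mem_CpVar_iff (hp.trans_le hpq)]
  refine (powVarOn_le_mul_powVarOn γ univ hp.le hpq (ε := pVar p (increment γ))
    fun a b hab => enorm_le_pVar hp (α := increment γ) (fun x => sub_self _) hab).trans_lt ?_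
  exact ENNReal.mul_lt_top (ENNReal.rpow_lt_top_of_nonneg (sub_nonneg.2 hpq) hγ'.ne)
    ((mem_CpVar_iff hp γ).1 hγ)

theorem mem_CpVar_of_tendsto {p : ℝ} (hp : 1 ≤ p) {γ : C(Icc (0 : ℝ) T, E)}
    {γs : ℕ → C(Icc (0 : ℝ) T, E)} (hγs : ∀ n, γs n ∈ CpVar E T p)
    (h : Tendsto (fun n => pVar p (increment (γ - γs n))) atTop (𝓝 0)) : γ ∈ CpVar E T p := by
  obtain ⟨n, hn⟩ := (h.eventually_lt_const zero_lt_one).exists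
  rw [← sub_add_cancel γ (γs n)]
  exact add_mem_CpVar hp (hn.trans ENNReal.one_lt_top) (hγs n)

theorem mem_CpVar_one_of_norm_sub_le (f : C(Icc (0 : ℝ) T, E)) {K : ℝ} (hK : 0 ≤ K)
    (h : ∀ s t : Icc (0 : ℝ) T, s ≤ t → ‖f t - f s‖ ≤ K * (t - s)) : f ∈ CpVar E T 1 := by
  rw [mem_CpVar_iff one_pos]
  refine lt_of_le_of_lt (iSup_le ?_) (ENNReal.ofReal_lt_top (r := K * T))
  rintro ⟨n, u, hu, -⟩
  calc ∑ i ∈ Finset.range n, ‖f (u (i + 1)) - f (u i)‖ₑ ^ (1 : ℝ)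
      ≤ ∑ i ∈ Finset.range n, ENNReal.ofReal (K * ((u (i + 1) : ℝ) - u i)) := by
        refine Finset.sum_le_sum fun i _ => ?_
        rw [ENNReal.rpow_one, ← ofReal_norm]
        exact ENNReal.ofReal_le_ofReal (h _ _ (hu (Nat.le_succ i)))
    _ = ENNReal.ofReal (K * ((u n : ℝ) - u 0)) := by
        rw [← ENNReal.ofReal_sum_of_nonneg, ← Finset.mul_sum,
          Finset.sum_range_sub (fun i => (u i : ℝ))]
        intro i _
        exact mul_nonneg hK (sub_nonneg.2 (hu (Nat.le_succ i)))
    _ ≤ ENNReal.ofReal (K * T) := by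
        refine ENNReal.ofReal_le_ofReal (mul_le_mul_of_nonneg_left ?_ hK)
        linarith [(u n).2.2, (u 0).2.1]

end Interpolation

/-! ### Approximation by averages over translates -/

section Mollify

variable {T : ℝ} {V : Type*} [NormedAddCommGroup V] [NormedSpace ℝ V]

/-- The average `∫_0^1 h(t + δ u) du` of the translates of `h`, where `h` is extended to the real
line by constants. -/
noncomputable def mollify (hT : 0 ≤ T) (h : C(Icc (0 : ℝ) T, V)) (δ : ℝ) :
    C(Icc (0 : ℝ) T, V) where
  toFun t := ∫ u in (0 : ℝ)..1, h (projIcc 0 T hT (t + δ * u))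
  continuous_toFun := by
    refine intervalIntegral.continuous_parametric_intervalIntegral_of_continuous' ?_ 0 1
    have := continuous_projIcc (h := hT)
    fun_prop

variable (hT : 0 ≤ T) (h : C(Icc (0 : ℝ) T, V))

theorem continuous_comp_projIcc {X : Type*} [TopologicalSpace X] (h : C(Icc (0 : ℝ) T, X)) :
    Continuous fun x => h (projIcc 0 T hT x) :=
  h.continuous.comp continuous_projIcc

theorem mollify_sub_mollify (δ : ℝ) (s t : Icc (0 : ℝ) T) :
    mollify hT h δ t - mollify hT h δ s =
      ∫ u in (0 : ℝ)..1, (h (projIcc 0 T hT (t + δ * u)) - h (projIcc 0 T hT (s + δ * u))) := by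
  have hc := continuous_comp_projIcc hT h
  refine (intervalIntegral.integral_sub ?_ ?_).symm <;>
    exact Continuous.intervalIntegrable (hc.comp (by fun_prop)) _ _

theorem mollify_mem_CpVar_one [CompleteSpace V] {δ : ℝ} (hδ : 0 < δ) :
    mollify hT h δ ∈ CpVar V T 1 := by
  have hc := continuous_comp_projIcc hT h
  have hint : ∀ a b : ℝ, IntervalIntegrable (fun x => h (projIcc 0 T hT x))
      MeasureTheory.volume a b := fun a b => hc.intervalIntegrable a b
  have hbd : ∀ a b : ℝ, a ≤ b → ‖∫ x in a..b, h (projIcc 0 T hT x)‖ ≤ ‖h‖ * (b - a) := by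
    intro a b hab
    rw [← abs_of_nonneg (sub_nonneg.2 hab)]
    exact intervalIntegral.norm_integral_le_of_norm_le_const fun x _ => h.norm_coe_le_norm _
  have hm : ∀ t : Icc (0 : ℝ) T, mollify hT h δ t =
      δ⁻¹ • ∫ x in (t : ℝ)..(t + δ), h (projIcc 0 T hT x) := by
    intro t
    change ∫ u in (0 : ℝ)..1, h (projIcc 0 T hT (t + δ * u)) = _
    rw [intervalIntegral.integral_comp_add_mul (fun x => h (projIcc 0 T hT x)) hδ.ne']
    simp
  -- The average over `[t, t + δ]` is Lipschitz in `t`.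
  refine mem_CpVar_one_of_norm_sub_le _ (K := δ⁻¹ * (2 * ‖h‖)) (by positivity) fun s t hst => ?_
  have hst' : (s : ℝ) ≤ t := hst
  rw [hm, hm, ← smul_sub, norm_smul, Real.norm_of_nonneg (by positivity),
    intervalIntegral.integral_interval_sub_interval_comm' (hint _ _) (hint _ _) (hint _ _),
    mul_assoc]
  gcongr
  refine (norm_sub_le _ _).trans ?_
  have h1 := hbd (s + δ) (t + δ) (by linarith)
  have h2 := hbd s t hst
  linarith

/-- By Jensen's inequality, averaging does not increase the `p`-variation. -/
theorem powVarOn_mollify_le {p : ℝ} (hp : 1 ≤ p) (δ : ℝ) :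
    powVarOn p (mollify hT h δ) univ ≤ powVarOn p h univ := by
  have hc := continuous_comp_projIcc hT h
  let μ : MeasureTheory.Measure ℝ := MeasureTheory.volume.restrict (Ioc 0 1)
  have : MeasureTheory.IsProbabilityMeasure μ := ⟨by simp [μ]⟩
  have hcont : ∀ s t : Icc (0 : ℝ) T, Continuous fun u : ℝ =>
      h (projIcc 0 T hT (t + δ * u)) - h (projIcc 0 T hT (s + δ * u)) := fun s t =>
    (hc.comp (by fun_prop)).sub (hc.comp (by fun_prop))
  have hjensen : ∀ s t : Icc (0 : ℝ) T, ‖mollify hT h δ t - mollify hT h δ s‖ₑ ^ p ≤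
      ∫⁻ u, ‖h (projIcc 0 T hT (t + δ * u)) - h (projIcc 0 T hT (s + δ * u))‖ₑ ^ p ∂μ := by
    intro s t
    rw [mollify_sub_mollify, intervalIntegral.integral_of_le zero_le_one]
    have h1 := MeasureTheory.eLpNorm'_le_eLpNorm'_of_exponent_le one_pos hp μ
      (hcont s t).aestronglyMeasurable
    simp only [MeasureTheory.eLpNorm', ENNReal.rpow_one, div_one, one_div] at h1
    rw [← ENNReal.le_rpow_inv_iff (by linarith)]
    exact (MeasureTheory.enorm_integral_le_lintegral_enorm _).trans h1
  refine iSup_le ?_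
  rintro ⟨n, u, hu, -⟩
  calc _ ≤ ∑ i ∈ Finset.range n, ∫⁻ x, ‖h (projIcc 0 T hT (u (i + 1) + δ * x)) -
          h (projIcc 0 T hT (u i + δ * x))‖ₑ ^ p ∂μ := Finset.sum_le_sum fun i _ => hjensen _ _
    _ = ∫⁻ x, ∑ i ∈ Finset.range n, ‖h (projIcc 0 T hT (u (i + 1) + δ * x)) -
          h (projIcc 0 T hT (u i + δ * x))‖ₑ ^ p ∂μ := by
        rw [MeasureTheory.lintegral_finsetSum]
        intro i _
        exact ((hcont _ _).enorm.measurable).pow_const p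
    _ ≤ ∫⁻ _, powVarOn p h univ ∂μ := by
        refine MeasureTheory.lintegral_mono fun x => ?_
        refine sum_le_powVarOn p h (u := fun i => projIcc 0 T hT (u i + δ * x)) ?_
          (fun _ => mem_univ _) n
        exact fun i j hij => monotone_projIcc hT (add_le_add (Subtype.coe_le_coe.2 (hu hij)) le_rfl)
    _ = powVarOn p h univ := by simp

theorem enorm_sub_mollify_le [CompleteSpace V] {ε : ℝ≥0} {δ : ℝ} (hδ : 0 ≤ δ)
    (hε : ∀ a b, dist a b ≤ δ → ‖h a - h b‖ₑ ≤ ε) (t : Icc (0 : ℝ) T) :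
    ‖h t - mollify hT h δ t‖ₑ ≤ ε := by
  have hc : Continuous fun u : ℝ => h (projIcc 0 T hT (t + δ * u)) :=
    (continuous_comp_projIcc hT h).comp (by fun_prop)
  have h1 : h t - mollify hT h δ t =
      ∫ u in (0 : ℝ)..1, (h (projIcc 0 T hT t) - h (projIcc 0 T hT (t + δ * u))) := by
    rw [intervalIntegral.integral_sub intervalIntegrable_const
      (hc.intervalIntegrable _ _), projIcc_val]
    simp [mollify]
  rw [h1, intervalIntegral.integral_of_le zero_le_one]
  refine (MeasureTheory.enorm_integral_le_lintegral_enorm _).trans ?_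
  refine (MeasureTheory.setLIntegral_mono measurable_const fun u hu =>
    hε _ _ ?_).trans (by simp)
  refine ((LipschitzWith.projIcc hT).dist_le_mul _ _).trans ?_
  rw [Real.dist_eq, NNReal.coe_one, one_mul, sub_add_cancel_left, abs_neg,
    abs_of_nonneg (mul_nonneg hδ hu.1.le)]
  exact mul_le_of_le_one_right hδ hu.2

/-- A path of finite `p`-variation is approximated by paths of bounded variation, simultaneously in
`q`-variation for every `q > p`. -/
theorem exists_tendsto_pVar_sub [CompleteSpace V] (hT : 0 ≤ T) {p : ℝ} (hp : 1 ≤ p)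
    {h : C(Icc (0 : ℝ) T, V)} (hh : h ∈ CpVar V T p) :
    ∃ hs : ℕ → C(Icc (0 : ℝ) T, V), (∀ n, hs n ∈ CpVar V T 1) ∧
      ∀ q > p, Tendsto (fun n => pVar q (increment (h - hs n))) atTop (𝓝 0) := by
  have hp0 : 0 < p := by linarith
  have hex : ∀ n : ℕ, ∃ δ > 0, ∀ a b, dist a b ≤ δ →
      ‖h a - h b‖ₑ ≤ ((1 / (n + 1) : ℝ≥0) : ℝ≥0∞) :=
    fun n => exists_dist_le_enorm_sub_le h (by positivity)
  choose δ hδ hδ' using hex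
  refine ⟨fun n => mollify hT h (δ n), fun n => mollify_mem_CpVar_one hT h (hδ n),
    fun q hpq => ?_⟩
  have hq0 : 0 < q := hp0.trans hpq
  set M := powVarOn p h univ with hM
  have hMtop : M < ∞ := (mem_CpVar_iff hp0 h).1 hh
  have hvar : ∀ n, powVarOn p (h - mollify hT h (δ n)) univ ≤ (M ^ (1 / p) + M ^ (1 / p)) ^ p := by
    intro n
    have h1 := powVarOn_eq_pVar_rpow hp0 (h - mollify hT h (δ n))
    rw [h1, increment_sub, sub_eq_add_neg]
    refine ENNReal.rpow_le_rpow ((pVar_add_le hp _ _).trans ?_) hp0.le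
    rw [pVar_neg, pVar_increment hp0, pVar_increment hp0]
    gcongr
    exact powVarOn_mollify_le hT h hp _
  have hbound : ∀ n : ℕ, pVar q (increment (h - mollify hT h (δ n))) ≤
      ((((1 / (n + 1) : ℝ≥0) : ℝ≥0∞) + ((1 / (n + 1) : ℝ≥0) : ℝ≥0∞)) ^ (q - p) *
        (M ^ (1 / p) + M ^ (1 / p)) ^ p) ^ (1 / q) := by
    intro n
    rw [pVar_increment hq0]
    refine ENNReal.rpow_le_rpow ((powVarOn_le_mul_powVarOn _ _ hp0.le hpq.le
      (ε := ((1 / (n + 1) : ℝ≥0) : ℝ≥0∞) + ((1 / (n + 1) : ℝ≥0) : ℝ≥0∞))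
      fun a b _ => ?_).trans ?_)
      (by positivity)
    · refine (enorm_sub_le).trans (add_le_add ?_ ?_) <;>
        exact enorm_sub_mollify_le hT h (hδ n).le (hδ' n) _
    · gcongr
      exact hvar n
  refine tendsto_of_tendsto_of_tendsto_of_le_of_le tendsto_const_nhds ?_ (fun _ => zero_le) hbound
  have hlim : Tendsto (fun n : ℕ => ((1 / (n + 1) : ℝ≥0) : ℝ≥0∞)) atTop (𝓝 0) := by
    rw [← ENNReal.coe_zero, ENNReal.tendsto_coe]
    exact NNReal.tendsto_coe.1 (by simpa using tendsto_one_div_add_atTop_nhds_zero_nat (𝕜 := ℝ))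
  have hsum := hlim.add hlim
  rw [add_zero] at hsum
  have hpow := (ENNReal.continuous_rpow_const (y := q - p)).continuousAt.tendsto.comp hsum
  have hfin : (M ^ (1 / p) + M ^ (1 / p)) ^ p ≠ ∞ := by
    have : M ^ (1 / p) < ∞ := ENNReal.rpow_lt_top_of_nonneg (by positivity) hMtop.ne
    exact (ENNReal.rpow_lt_top_of_nonneg hp0.le (ENNReal.add_lt_top.2 ⟨this, this⟩).ne).ne
  have hmul := ENNReal.Tendsto.mul_const hpow (Or.inr hfin)
  have hfinal := (ENNReal.continuous_rpow_const (y := 1 / q)).continuousAt.tendsto.comp hmul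
  rw [ENNReal.zero_rpow_of_pos (sub_pos.2 hpq), zero_mul,
    ENNReal.zero_rpow_of_pos (by positivity)] at hfinal
  exact hfinal

end Mollify

/-! ### Completeness in `p`-variation -/

section Complete

variable {T : ℝ} {E : Type*} [NormedAddCommGroup E]

theorem IsTriangleFun.add {α β : Icc (0 : ℝ) T → Icc (0 : ℝ) T → E} (hα : IsTriangleFun α)
    (hβ : IsTriangleFun β) : IsTriangleFun (α + β) :=
  ⟨hα.1.add hβ.1, fun t => by simp [hα.2 t, hβ.2 t]⟩

theorem exists_tendsto_pVar_of_cauchy [CompleteSpace E] {p : ℝ} (hp : 0 < p)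
    {Z : ℕ → Icc (0 : ℝ) T → Icc (0 : ℝ) T → E} (hZ : ∀ n, IsTriangleFun (Z n))
    (hc : Tendsto (fun q : ℕ × ℕ => pVar p (Z q.1 - Z q.2)) (atTop ×ˢ atTop) (𝓝 0)) :
    ∃ L, IsTriangleFun L ∧ Tendsto (fun n => pVar p (L - Z n)) atTop (𝓝 0) := by
  have hc' : ∀ ε > 0, ∃ N, ∀ n ≥ N, ∀ m ≥ N, pVar p (Z n - Z m) ≤ ε := by
    intro ε hε
    have := ENNReal.tendsto_nhds_zero.1 hc ε hε
    rwa [prod_atTop_atTop_eq, eventually_atTop_prod_self'] at this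
  have hlim : ∀ s t : Icc (0 : ℝ) T, ∃ l, s ≤ t → Tendsto (fun n => Z n s t) atTop (𝓝 l) := by
    intro s t
    by_cases hst : s ≤ t
    · have : CauchySeq fun n => Z n s t := by
        refine EMetric.cauchySeq_iff.2 fun ε hε => ?_
        obtain ⟨ε', hε', hlt⟩ := exists_between hε
        obtain ⟨N, hN⟩ := hc' ε' hε'
        refine ⟨N, fun m hm n hn => lt_of_le_of_lt ?_ hlt⟩
        rw [edist_eq_enorm_sub]
        exact (enorm_le_pVar hp (α := Z m - Z n)
          (fun x => by simp [(hZ m).2 x, (hZ n).2 x]) hst).trans (hN m hm n hn)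
      obtain ⟨l, hl⟩ := cauchySeq_tendsto_of_complete this
      exact ⟨l, fun _ => hl⟩
    · exact ⟨0, fun h => absurd h hst⟩
  choose L hL using hlim
  have hdiag : ∀ t, L t t = 0 := fun t =>
    tendsto_nhds_unique (hL t t le_rfl) (by simp [(hZ _).2 t])
  have hconv : Tendsto (fun n => pVar p (L - Z n)) atTop (𝓝 0) := by
    rw [ENNReal.tendsto_nhds_zero]
    intro ε hε
    obtain ⟨N, hN⟩ := hc' ε hε
    filter_upwards [eventually_ge_atTop N] with n hn
    rw [pVar_le_iff hp]
    intro D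
    have htend : Tendsto (fun m => powSum p (Z m - Z n) D) atTop (𝓝 (powSum p (L - Z n) D)) := by
      refine tendsto_finsetSum _ fun i hi => ?_
      refine (ENNReal.continuous_rpow_const (y := p)).continuousAt.tendsto.comp ?_
      exact ((hL _ _ (D.lt_succ i (Finset.mem_range.1 hi)).le).sub tendsto_const_nhds).enorm
    refine le_of_tendsto htend ?_
    filter_upwards [eventually_ge_atTop N] with m hm
    exact (pVar_le_iff hp _ _).1 (hN m hm n hn) D
  refine ⟨L, ⟨?_, hdiag⟩, hconv⟩
  have hunif : TendstoUniformlyOn (fun n (q : Icc (0 : ℝ) T × Icc (0 : ℝ) T) => Z n q.1 q.2)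
      (fun q => L q.1 q.2) atTop {q | q.1 ≤ q.2} := by
    rw [EMetric.tendstoUniformlyOn_iff]
    intro ε hε
    filter_upwards [hconv.eventually_lt_const hε] with n hn q hq
    rw [edist_eq_enorm_sub]
    exact (enorm_le_pVar hp (α := L - Z n)
      (fun x => by simp [hdiag x, (hZ n).2 x]) hq).trans_lt hn
  exact hunif.continuousOn (Frequently.of_forall fun n => (hZ n).1)

end Complete

/-! ### Convergence of areas -/

section Limit

variable {V : Type*} [NormedAddCommGroup V] [NormedSpace ℝ V] {T : ℝ}
  {E : Type*} [NormedAddCommGroup E] [NormedSpace ℝ E] [CompleteSpace E]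
  (B : V →L[ℝ] V →L[ℝ] E)

/-- If `f_n → f` in `p`-variation and `g_n → g` in `q`-variation, where `1/p + 1/q > 1`, then the
areas of `f_n` and `g_n` converge in `1`-variation. The limit is the area of `f` and `g` in the
sense of Young. -/
theorem exists_tendsto_bilinArea {p q : ℝ} (hp : 1 ≤ p) (hq : 1 ≤ q) (hpq : 1 < 1 / p + 1 / q)
    {f g : C(Icc (0 : ℝ) T, V)} {fs gs : ℕ → C(Icc (0 : ℝ) T, V)}
    (hfs : ∀ n, fs n ∈ CpVar V T 1) (hgs : ∀ n, gs n ∈ CpVar V T 1)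
    (hf : Tendsto (fun n => pVar p (increment (f - fs n))) atTop (𝓝 0))
    (hg : Tendsto (fun n => pVar q (increment (g - gs n))) atTop (𝓝 0)) :
    ∃ L, IsTriangleFun L ∧
      Tendsto (fun n => pVar 1 (L - bilinArea B (fs n) (gs n))) atTop (𝓝 0) := by
  have hp0 : 0 < p := by linarith
  have hq0 : 0 < q := by linarith
  refine exists_tendsto_pVar_of_cauchy one_pos
    (fun n => isTriangleFun_bilinArea B (fs n) (hgs n)) ?_
  have hF : pVar p (increment f) ≠ ∞ :=
    (mem_CpVar_of_tendsto hp (fun n => CpVar_subset one_pos hp (hfs n)) hf).ne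
  have hG : pVar q (increment g) ≠ ∞ :=
    (mem_CpVar_of_tendsto hq (fun n => CpVar_subset one_pos hq (hgs n)) hg).ne
  have hnorm : ∀ {r : ℝ} (_ : 1 ≤ r) (a b : C(Icc (0 : ℝ) T, V)),
      pVar r (increment b) ≤ pVar r (increment a) + pVar r (increment (a - b)) := by
    intro r hr a b
    have h1 := pVar_add_le hr (increment a) (increment b - increment a)
    rwa [add_sub_cancel, pVar_sub_comm, ← increment_sub] at h1
  have hdist : ∀ {r : ℝ} (_ : 1 ≤ r) (a b c : C(Icc (0 : ℝ) T, V)),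
      pVar r (increment (b - c)) ≤ pVar r (increment (a - b)) + pVar r (increment (a - c)) := by
    intro r hr a b c
    have h1 := pVar_add_le hr (increment b - increment a) (increment a - increment c)
    rwa [sub_add_sub_cancel, pVar_sub_comm _ (increment b) (increment a), ← increment_sub,
      ← increment_sub, ← increment_sub] at h1
  set K := youngConst (1 / p + 1 / q) * ‖B‖ₑ with hK
  have hKtop : K ≠ ∞ := (ENNReal.mul_lt_top (youngConst_lt_top hpq) enorm_lt_top).ne
  set a := fun n => pVar p (increment (f - fs n)) with ha
  set b := fun n => pVar q (increment (g - gs n)) with hb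
  have hbound : ∀ x : ℕ × ℕ,
      pVar 1 (bilinArea B (fs x.1) (gs x.1) - bilinArea B (fs x.2) (gs x.2)) ≤
      K * ((a x.1 + a x.2) * (pVar q (increment g) + b x.1)) +
        K * ((pVar p (increment f) + a x.2) * (b x.1 + b x.2)) := by
    rintro ⟨n, m⟩
    have hsplit : pVar 1 (bilinArea B (fs n) (gs n) - bilinArea B (fs m) (gs m)) ≤
        pVar 1 (bilinArea B (fs n - fs m) (gs n) + bilinArea B (fs m) (gs n - gs m)) := by
      refine pVar_mono one_pos fun s t hst => le_of_eq ?_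
      simp only [Pi.sub_apply, Pi.add_apply]
      rw [bilinArea_sub_left B _ _ (hgs n) hst, bilinArea_sub_right B _ (hgs n) (hgs m) hst,
        sub_add_sub_cancel]
    refine hsplit.trans ((pVar_add_le le_rfl _ _).trans (add_le_add ?_ ?_))
    · refine (pVar_one_bilinArea_le B _ (hgs n) hp0 hq0 hpq.le).trans ?_
      rw [← mul_assoc]
      gcongr
      · exact hdist hp f _ _
      · exact hnorm hq g _
    · refine (pVar_one_bilinArea_le B _ (sub_mem_CpVar le_rfl (hgs n) (hgs m)) hp0 hq0
        hpq.le).trans ?_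
      rw [← mul_assoc]
      gcongr
      · exact hnorm hp f _
      · exact hdist hq g _ _
  refine tendsto_of_tendsto_of_tendsto_of_le_of_le tendsto_const_nhds ?_ (fun _ => zero_le) hbound
  have ha1 : Tendsto (fun x : ℕ × ℕ => a x.1) (atTop ×ˢ atTop) (𝓝 0) := hf.comp tendsto_fst
  have ha2 : Tendsto (fun x : ℕ × ℕ => a x.2) (atTop ×ˢ atTop) (𝓝 0) := hf.comp tendsto_snd
  have hb1 : Tendsto (fun x : ℕ × ℕ => b x.1) (atTop ×ˢ atTop) (𝓝 0) := hg.comp tendsto_fst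
  have hb2 : Tendsto (fun x : ℕ × ℕ => b x.2) (atTop ×ˢ atTop) (𝓝 0) := hg.comp tendsto_snd
  have h1 := ENNReal.Tendsto.const_mul (a := K) (ENNReal.Tendsto.mul (ha1.add ha2)
    (Or.inr (by simpa using hG)) ((tendsto_const_nhds (x := pVar q (increment g))).add hb1)
    (Or.inr (by simp))) (Or.inr hKtop)
  have h2 := ENNReal.Tendsto.const_mul (a := K) (ENNReal.Tendsto.mul
    ((tendsto_const_nhds (x := pVar p (increment f))).add ha2) (Or.inr (by simp))
    (hb1.add hb2) (Or.inr (by simpa using hF))) (Or.inr hKtop)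
  simpa using h1.add h2

/-- Adding a path `h` of finite `p`-variation, `p < 2`, to a limit `(γ, α)` of paths of bounded
variation and their areas: the cross terms and the area of `h` are Young integrals. -/
theorem exists_tendsto_bilinArea_add [CompleteSpace V] (hT : 0 ≤ T) {p : ℝ} (hp : 1 ≤ p)
    (hp2 : p < 2) {γ h : C(Icc (0 : ℝ) T, V)} (hh : h ∈ CpVar V T p)
    {α : Icc (0 : ℝ) T → Icc (0 : ℝ) T → E} (hα : IsTriangleFun α)
    {γs : ℕ → C(Icc (0 : ℝ) T, V)} (hγs : ∀ n, γs n ∈ CpVar V T 1)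
    (hγ : Tendsto (fun n => pVar 2 (increment (γ - γs n))) atTop (𝓝 0))
    (hαγ : Tendsto (fun n => pVar 1 (α - bilinArea B (γs n) (γs n))) atTop (𝓝 0)) :
    ∃ (β : Icc (0 : ℝ) T → Icc (0 : ℝ) T → E) (ηs : ℕ → C(Icc (0 : ℝ) T, V)),
      IsTriangleFun β ∧ (∀ n, ηs n ∈ CpVar V T 1) ∧
      Tendsto (fun n => pVar 2 (increment (γ + h - ηs n))) atTop (𝓝 0) ∧
      Tendsto (fun n => pVar 1 (β - bilinArea B (ηs n) (ηs n))) atTop (𝓝 0) := by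
  -- an exponent `q` with `p < q < 2`: approximation needs `p < q`, Young's condition `q < 2`
  obtain ⟨q, hpq, hq2⟩ := exists_between hp2
  have hq1 : 1 ≤ q := by linarith
  have hqhalf : 1 / 2 < 1 / q := one_div_lt_one_div_of_lt (by linarith) hq2
  obtain ⟨hs, hhs, hconv⟩ := exists_tendsto_pVar_sub hT hp hh
  have hhq := hconv q hpq
  have hh2 := hconv 2 hp2
  obtain ⟨L₁, hL₁, hL₁'⟩ := exists_tendsto_bilinArea B hq1 hq1 (by linarith) hhs hhs hhq hhq
  obtain ⟨L₂, hL₂, hL₂'⟩ := exists_tendsto_bilinArea B one_le_two hq1 (by linarith) hγs hhs hγ hhq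
  obtain ⟨L₃, hL₃, hL₃'⟩ := exists_tendsto_bilinArea B hq1 one_le_two (by linarith) hhs hγs hhq hγ
  refine ⟨α + L₁ + L₂ + L₃, fun n => γs n + hs n, ((hα.add hL₁).add hL₂).add hL₃,
    fun n => add_mem_CpVar le_rfl (hγs n) (hhs n), ?_, ?_⟩
  · have hsum := hγ.add hh2
    rw [add_zero] at hsum
    refine tendsto_of_tendsto_of_tendsto_of_le_of_le tendsto_const_nhds hsum
      (fun _ => zero_le) fun n => ?_
    rw [add_sub_add_comm, increment_add]
    exact pVar_add_le one_le_two _ _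
  · have hsum := ((hαγ.add hL₁').add hL₂').add hL₃'
    simp only [add_zero] at hsum
    refine tendsto_of_tendsto_of_tendsto_of_le_of_le tendsto_const_nhds hsum
      (fun _ => zero_le) fun n => ?_
    refine le_trans (pVar_mono one_pos fun s t hst => le_of_eq ?_)
      ((pVar_add_le le_rfl ((α - bilinArea B (γs n) (γs n)) + (L₁ - bilinArea B (hs n) (hs n)) +
        (L₂ - bilinArea B (γs n) (hs n))) (L₃ - bilinArea B (hs n) (γs n))).trans
      (add_le_add_left ((pVar_add_le le_rfl _ _).trans
        (add_le_add_left (pVar_add_le le_rfl _ _) _)) _))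
    simp only [Pi.sub_apply, Pi.add_apply]
    rw [bilinArea_add_left B _ _ (add_mem_CpVar le_rfl (hγs n) (hhs n)) hst,
      bilinArea_add_right B _ (hγs n) (hhs n) hst, bilinArea_add_right B _ (hγs n) (hhs n) hst]
    congr 1
    abel

end Limit

/-! ### The bracket and geometric rough paths -/

section Geometric

variable {V : Type*} [NormedAddCommGroup V] [NormedSpace ℝ V] {T : ℝ} (N : TensorNorm V)

theorem norm_bracket_le (v w : V) : ‖bracket N v w‖ ≤ 2 * ‖v‖ * ‖w‖ := by
  rw [bracket, UniformSpace.Completion.norm_coe]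
  change N.toSeminorm (v ⊗ₜ[ℝ] w - w ⊗ₜ[ℝ] v) ≤ _
  refine (map_sub_le_add N.toSeminorm _ _).trans ?_
  linarith [N.norm_tmul_le v w, N.norm_tmul_le w v]

/-- Instance search finds several norms on `[V, V]`, not all of them recognizably equal. This
instance fixes the one used in `area` and `roughNorm`. -/
noncomputable local instance (priority := 2000) : NormedAddCommGroup (BracketSpace N) :=
  UniformSpace.Completion.instNormedAddCommGroup (bracketSpan N)

noncomputable local instance (priority := 2000) : NormedSpace ℝ (BracketSpace N) :=
  UniformSpace.Completion.instNormedSpace ℝ (bracketSpan N)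

/-- The bracket as a bounded bilinear map. By definition, `areaPair N` is
`bilinArea (bracketL N)`. -/
noncomputable def bracketL : V →L[ℝ] V →L[ℝ] BracketSpace N :=
  LinearMap.mkContinuous₂
    (LinearMap.mk₂ ℝ (bracket N)
      (fun v v' w => by
        rw [bracket, bracket, bracket, ← UniformSpace.Completion.coe_add]
        congr 1
        refine Subtype.ext ?_
        change ((v + v') ⊗ₜ[ℝ] w - w ⊗ₜ[ℝ] (v + v') : V ⊗[ℝ] V) =
          (v ⊗ₜ[ℝ] w - w ⊗ₜ[ℝ] v) + (v' ⊗ₜ[ℝ] w - w ⊗ₜ[ℝ] v')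
        rw [TensorProduct.add_tmul, TensorProduct.tmul_add]
        abel)
      (fun c v w => by
        rw [bracket, bracket, ← UniformSpace.Completion.coe_smul]
        congr 1
        refine Subtype.ext ?_
        change ((c • v) ⊗ₜ[ℝ] w - w ⊗ₜ[ℝ] (c • v) : V ⊗[ℝ] V) =
          c • (v ⊗ₜ[ℝ] w - w ⊗ₜ[ℝ] v)
        simp only [TensorProduct.tmul_smul, TensorProduct.smul_tmul', smul_sub])
      (fun v w w' => by
        rw [bracket, bracket, bracket, ← UniformSpace.Completion.coe_add]
        congr 1
        refine Subtype.ext ?_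
        change (v ⊗ₜ[ℝ] (w + w') - (w + w') ⊗ₜ[ℝ] v : V ⊗[ℝ] V) =
          (v ⊗ₜ[ℝ] w - w ⊗ₜ[ℝ] v) + (v ⊗ₜ[ℝ] w' - w' ⊗ₜ[ℝ] v)
        rw [TensorProduct.add_tmul, TensorProduct.tmul_add]
        abel)
      (fun c v w => by
        rw [bracket, bracket, ← UniformSpace.Completion.coe_smul]
        congr 1
        refine Subtype.ext ?_
        change (v ⊗ₜ[ℝ] (c • w) - (c • w) ⊗ₜ[ℝ] v : V ⊗[ℝ] V) =
          c • (v ⊗ₜ[ℝ] w - w ⊗ₜ[ℝ] v)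
        simp only [TensorProduct.tmul_smul, TensorProduct.smul_tmul', smul_sub]))
    2 (norm_bracket_le N)

variable {N}

theorem tendsto_roughNorm_iff {γs : ℕ → C(Icc (0 : ℝ) T, V)}
    {αs : ℕ → Icc (0 : ℝ) T → Icc (0 : ℝ) T → BracketSpace N} :
    Tendsto (fun n => roughNorm (γs n) (αs n)) atTop (𝓝 0) ↔
      Tendsto (fun n => pVar 2 (increment (γs n))) atTop (𝓝 0) ∧
        Tendsto (fun n => pVar 1 (αs n)) atTop (𝓝 0) := by
  constructor
  · intro h
    have h2 := (ENNReal.continuous_rpow_const (y := 2)).continuousAt.tendsto.comp h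
    rw [ENNReal.zero_rpow_of_pos two_pos] at h2
    have h2' : ∀ n, roughNorm (γs n) (αs n) ^ (2 : ℝ) =
        pVar 2 (increment (γs n)) ^ (2 : ℝ) + pVar 1 (αs n) := fun n => by
      rw [roughNorm, ← ENNReal.rpow_mul, one_div_mul_cancel two_ne_zero, ENNReal.rpow_one]
    constructor
    · refine tendsto_of_tendsto_of_tendsto_of_le_of_le tendsto_const_nhds h (fun _ => zero_le)
        fun n => ?_
      rw [← ENNReal.rpow_le_rpow_iff two_pos, h2' n]
      exact le_self_add
    · refine tendsto_of_tendsto_of_tendsto_of_le_of_le tendsto_const_nhds h2 (fun _ => zero_le)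
        fun n => ?_
      simp only [Function.comp_apply, h2' n]
      exact le_add_self
  · rintro ⟨h1, h2⟩
    have h3 := ((ENNReal.continuous_rpow_const (y := 2)).continuousAt.tendsto.comp h1).add h2
    have h4 := (ENNReal.continuous_rpow_const (y := 1 / 2)).continuousAt.tendsto.comp h3
    rw [ENNReal.zero_rpow_of_pos two_pos, add_zero, ENNReal.zero_rpow_of_pos (by norm_num)] at h4
    exact h4

/-- Both vanishing conditions in the definition of `𝒢₂(V)` hold for paths of bounded variation,
hence for every geometric `2`-rough path. -/
theorem IsGeometricRoughPath.mem_G2 {γ : C(Icc (0 : ℝ) T, V)}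
    {α : Icc (0 : ℝ) T → Icc (0 : ℝ) T → BracketSpace N} (h : IsGeometricRoughPath N γ α) :
    γ ∈ G2 N T := by
  obtain ⟨hα, γs, hγs, hlim⟩ := id h
  obtain ⟨h2, h1⟩ := tendsto_roughNorm_iff.1 hlim
  refine ⟨?_, α, hα, ?_, h⟩
  · refine VanishingVar.of_tendsto one_le_two
      (fun n => vanishingVar_two_of_mem_CpVar_one (hγs n)) ?_
    simpa only [increment_sub] using h2
  · exact VanishingVar.of_tendsto le_rfl
      (fun n => vanishingVar_bilinArea_self (bracketL N) (hγs n)) h1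

theorem add_mem_G2 [CompleteSpace V] (hT : 0 ≤ T) {p : ℝ} (hp : 1 ≤ p) (hp2 : p < 2)
    {γ h : C(Icc (0 : ℝ) T, V)} (hγ : γ ∈ G2 N T) (hh : h ∈ CpVar V T p) : γ + h ∈ G2 N T := by
  obtain ⟨-, α, -, -, hα, γs, hγs, hlim⟩ := hγ
  obtain ⟨h2, h1⟩ := tendsto_roughNorm_iff.1 hlim
  obtain ⟨β, ηs, hβ, hηs, h2', h1'⟩ :=
    exists_tendsto_bilinArea_add (bracketL N) hT hp hp2 hh hα hγs h2 h1
  exact IsGeometricRoughPath.mem_G2 (α := β) ⟨hβ, ηs, hηs, tendsto_roughNorm_iff.2 ⟨h2', h1'⟩⟩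

end Geometric

end RoughPath

theorem mainTheorem9 {V : Type*} [NormedAddCommGroup V] [NormedSpace ℝ V] [CompleteSpace V]
    (N : RoughPath.TensorNorm V) {T : ℝ} (hT : 0 < T) :
    RoughPath.G2 N T + (⋃ p ∈ Set.Ico (1 : ℝ) 2, RoughPath.CpVar V T p) =
      RoughPath.G2 N T := by
  apply Set.Subset.antisymm
  · rintro _ ⟨γ, hγ, h, hh, rfl⟩
    simp only [Set.mem_iUnion] at hh
    obtain ⟨p, hp, hhp⟩ := hh
    exact RoughPath.add_mem_G2 hT.le hp.1 hp.2 hγ hhp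
  · intro γ hγ
    refine ⟨γ, hγ, 0, ?_, add_zero γ⟩
    simp only [Set.mem_iUnion]
    refine ⟨1, ⟨le_rfl, one_lt_two⟩, ?_⟩
    rw [RoughPath.mem_CpVar_iff one_pos]
    simp [RoughPath.powVarOn]
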